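/- For integers $s_1,\dots,s_r\ge 1$ and complex numbers $x_1,\dots,x_r$ put $$\mathrm{Li}_{s_1,\dots,s_r}(x_1,\dots,x_r)=\lim_{N\to\infty}\ \sum_{N\ge n_1>\cdots>n_r>0}\frac{x_1^{n_1}\cdots x_r^{n_r}}{n_1^{s_1}\cdots n_r^{s_r}}$$ whenever the limit exists, and put $\beta(s)=\lim_{N\to\infty}\sum_{n=1}^{N}\frac{(-1)^{n-1}}{(2n-1)^s}$ for integers $s\ge 1$. For signs $\sigma_1,\dots,\sigma_r\in\{\pm1\}$ let $$S^{\sigma_1,\dots,\sigma_r}(s_1,\dots,s_r)=\lim_{N\to\infty}\ \sum_{N\ge n_1>\cdots>n_r>0}\ \prod_{j=1}^r\frac{\bigl(1+\varepsilon_j(-1)^{n_j}\bigr)\,\sigma_j^{(2n_j+1-\varepsilon_j)/4}}{n_j^{s_j}},\qquad \varepsilon_j=(-1)^{r-j}$$ (a term is $0$ unless $n_j$ is even whenever $\varepsilon_j=1$ and odd whenever $\varepsilon_j=-1$), and write a bar over $s_j$ exactly when $\sigma_j=-1$. Let $\{1\}_{n}$ denote the string $1,\dots,1$ of length $n$, and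 let $\delta_P$ be $1$ if $P$ holds and $0$ otherwise; the term $\delta_{p\ge 1}\mathrm{Li}_{p+1}(1)$ is read as $0$ when $p=0$. Theorem. Let $m\ge 1$. All the limits defining the quantities in the formula below exist; more generally, $\beta(s)$ for all $s\ge1$, $\mathrm{Li}_s(-1)$ and $\mathrm{Li}_s(i)$ for all $s\ge 1$, $\mathrm{Li}_s(1)$ for all $s\ge 2$, $\mathrm{Li}_{1,m+1}(x,y)$ for $x\in\{-1,i,-i\}$ and $y\in\{1,-1,i,-i\}$, and $\mathrm{Li}_{m+1,1}(\pm i,1)$ exist. Moreover $$\begin{aligned} S(\overline{2},\{1\}_{m-1},\overline{1})= i^{\,\delta_{m\text{ odd}}}\Big[\,&2i\,\beta(m+2)+\sum_{\substack{k+p+r=m\\ k,p,r\ge0}}2i(-1)^p\beta(r+1)\,(2-2^{-p})\,\mathrm{Li}_{p+1}(-1)\,\frac1{k!}\Big(\frac{i\pi}{2}\Big)^k\\ &+\sum_{\substack{p+r=m\\ p,r\ge0}}2i(-1)^{p+1}\beta(r+1)\big(2\,\mathrm{Li}_{p+1}(i)-\delta_{p\ge1}\mathrm{Li}_{p+1}(1)-\mathrm{Li}_{p+1}(-1)\big)\\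 &+2\,\mathrm{Li}_{1,m+1}(i,1)-2\,\mathrm{Li}_{1,m+1}(-1,1)+2\,\mathrm{Li}_{1,m+1}(-1,-1)-2\,\mathrm{Li}_{1,m+1}(i,-1)\\ &+\mathrm{Li}_{1,m+1}(-i,-i)+\mathrm{Li}_{1,m+1}(-1,i)-\mathrm{Li}_{1,m+1}(i,-i)+\mathrm{Li}_{m+1,1}(i,1)\\ &-\mathrm{Li}_{m+1,1}(-i,1)-\mathrm{Li}_{1,m+1}(-1,-i)-\mathrm{Li}_{1,m+1}(-i,i)+\mathrm{Li}_{1,m+1}(i,i)\Big]. \end{aligned}$$ -/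

import Mathlib

open Filter Topology

/-- The finite set of tuples `N ≥ n₁ > n₂ > ⋯ > n_r > 0` of natural numbers. -/
def decreasingTuples (r N : ℕ) : Finset (Fin r → ℕ) :=
  (Fintype.piFinset fun _ : Fin r => Finset.Icc 1 N).filter
    fun n => ∀ i j : Fin r, i < j → n j < n i

noncomputable section

/-- The truncation `N ≥ n₁ > ⋯ > n_r > 0` of the series defining the alternating multiple
mixed value with parities `ε`, signs `σ` and arguments `s`. The exponent `(2 n + 1 - ε) / 4`
is an exact integer quotient whenever the parity factor `1 + ε (-1) ^ n` is non-zero. -/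
def mixedPartial {r : ℕ} (ε σ : Fin r → ℤˣ) (s : Fin r → ℕ) (N : ℕ) : ℝ :=
  ∑ n ∈ decreasingTuples r N, ∏ j : Fin r,
    (1 + ((ε j : ℤ) : ℝ) * (-1) ^ n j) *
      (((σ j ^ ((2 * (n j : ℤ) + 1 - (ε j : ℤ)) / 4) : ℤˣ) : ℤ) : ℝ) / (n j : ℝ) ^ s j

/-- Parities of a multiple `S` value: they alternate, and the last one is even (`+1`). -/
def parityS (r : ℕ) : Fin r → ℤˣ := fun j => (-1) ^ (r - 1 - (j : ℕ))

/-- Truncation of the alternating multiple `S` value `S^σ(s)`. -/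
def multSPartial {r : ℕ} (σ : Fin r → ℤˣ) (s : Fin r → ℕ) (N : ℕ) : ℝ :=
  mixedPartial (parityS r) σ s N

/-- The alternating multiple `S` value `S^σ(s)`. -/
def multS {r : ℕ} (σ : Fin r → ℤˣ) (s : Fin r → ℕ) : ℝ :=
  limUnder atTop (multSPartial σ s)

/-- The truncation `N ≥ n₁ > ⋯ > n_r > 0` of the multiple polylogarithm series. -/
def polylogPartial {r : ℕ} (s : Fin r → ℕ) (x : Fin r → ℂ) (N : ℕ) : ℂ :=
  ∑ n ∈ decreasingTuples r N, ∏ j : Fin r, x j ^ n j / (n j : ℂ) ^ s j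

/-- The multiple polylogarithm `Li_{s₁,…,s_r}(x₁,…,x_r)`. -/
def polylog {r : ℕ} (s : Fin r → ℕ) (x : Fin r → ℂ) : ℂ :=
  limUnder atTop (polylogPartial s x)

/-- The first `N` terms `1 - 1 / 3 ^ s + 1 / 5 ^ s - ⋯` of the Dirichlet beta series. -/
def betaPartial (s N : ℕ) : ℝ :=
  ∑ n ∈ Finset.range N, (-1 : ℝ) ^ n / (2 * (n : ℝ) + 1) ^ s

/-- The Dirichlet beta function at a natural number. -/
def dirichletBeta (s : ℕ) : ℝ := limUnder atTop (betaPartial s)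

end

/-- A sequence of partial sums converges. -/
def SeqConverges {E : Type*} [TopologicalSpace E] (u : ℕ → E) : Prop :=
  ∃ a : E, Tendsto u atTop (𝓝 a)

/-- The arguments `(2, 1, …, 1, 1)`, of length `m + 1`. -/
def args21 (m : ℕ) : Fin (m + 1) → ℕ := fun j => if j = 0 then 2 else 1

/-- The signs `(-1, 1, …, 1, -1)`, of length `m + 1`: bars on the first and last argument. -/
def signsBarBar (m : ℕ) : Fin (m + 1) → ℤˣ :=
  fun j => if j = 0 ∨ j = Fin.last m then -1 else 1

/-! The `S` value is, up to the prefactor, the value at `t = i` of `G_m(t) = ∑ altCoeff m n / n * t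
^ n`. The series `F_q(t) = ∑ altCoeff q n * t ^ n` are iterated integrals: `G_m' = F_m / t`,
`F_{q+1}' = 2 F_q / (1 - t²)`, and `F_0' = -2t / (1 + t²)`. The substitution `t = (1 - s) / (1 + s)`
sends `s = 1` to `t = 0` and `s = -i` to `t = i`. It turns `dt / t` into `-2 ds / (1 - s²)`, `2 dt /
(1 - t²)` into `-ds / s`, and the innermost form into `2 (1 / (1 + s) - s / (1 + s²)) ds`. Repeated
integration by parts then moves all the `ds / s` onto the other factor and leaves integrals of depth
at most two.

Concretely, `partsSum X m - 4 * kernelIterated X m` has zero derivative on the right half disc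
(`hasDerivAt_partsSum`, `hasDerivAt_kernelIterated`), so its limits at `s = 1` and `s = -i` agree
(`partsSum_sub_eq`). The integration constants `X = chiNegI` and the shift in `logPow` make
`iteratedChi` vanish at `-i`. Hence `partsSum` tends to `0` at `1` and to `G_m(i)` at `-i`, and
`kernelIterated` supplies the polylogarithms.

Both endpoints lie on the circle of convergence, so the limits come from Abel's theorem in a Stolz
cone. At `-i` the double series with first argument `1` diverge; their divergence cancels against
`Li_1(1)` in `tendsto_kernelChi_sub_at_neg_I`, and `tsum_polylogTail_div` identifies what remains.
-/

/-! ### Power series in the open unit disc -/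

/-- The power series with coefficients `a`. -/
noncomputable def powSum (a : ℕ → ℂ) (z : ℂ) : ℂ := ∑' n, a n * z ^ n

theorem summable_of_norm_le_linear {a : ℕ → ℂ} {C : ℝ} (ha : ∀ n, ‖a n‖ ≤ C * (n + 1)) {z : ℂ}
    (hz : ‖z‖ < 1) : Summable fun n => a n * z ^ n := by
  have h1 : Summable fun n : ℕ => ((n : ℝ) ^ 1 * ‖z‖ ^ n) :=
    summable_pow_mul_geometric_of_norm_lt_one 1 (by simpa using hz)
  have h2 : Summable fun n : ℕ => ‖z‖ ^ n := summable_geometric_of_lt_one (norm_nonneg _) hz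
  refine Summable.of_norm_bounded ((h1.add h2).mul_left C) fun n => ?_
  rw [norm_mul, norm_pow]
  calc ‖a n‖ * ‖z‖ ^ n ≤ C * (n + 1) * ‖z‖ ^ n := by gcongr; exact ha n
    _ = _ := by ring

theorem summable_of_norm_le {a : ℕ → ℂ} {C : ℝ} (ha : ∀ n, ‖a n‖ ≤ C) {z : ℂ}
    (hz : ‖z‖ < 1) : Summable fun n => a n * z ^ n := by
  have hC : 0 ≤ C := (norm_nonneg _).trans (ha 0)
  refine summable_of_norm_le_linear (C := C) (fun n => (ha n).trans ?_) hz
  have : (0 : ℝ) ≤ n := Nat.cast_nonneg n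
  nlinarith

theorem hasDerivAt_powSum {c : ℕ → ℂ} {C : ℝ} (hc : ∀ n, ‖c n‖ ≤ C) {z : ℂ} (hz : ‖z‖ < 1) :
    HasDerivAt (powSum c) (∑' n, c n * (n * z ^ (n - 1))) z := by
  obtain ⟨r, hzr, hr⟩ := exists_between hz
  have hr0 : 0 < r := (norm_nonneg z).trans_lt hzr
  have hC : 0 ≤ C := (norm_nonneg _).trans (hc 0)
  have hu : Summable fun n : ℕ => C * ((n : ℝ) * r ^ (n - 1)) := by
    have h1 : Summable fun n : ℕ => ((n : ℝ) ^ 1 * r ^ n) :=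
      summable_pow_mul_geometric_of_norm_lt_one 1 (by simpa [abs_of_pos hr0] using hr)
    refine Summable.mul_left _ ((h1.mul_right r⁻¹).congr fun n => ?_)
    rcases n with _ | n
    · simp
    · rw [Nat.add_sub_cancel, pow_succ r, pow_one]; field_simp
  refine hasDerivAt_tsum_of_isPreconnected (g := fun n y => c n * y ^ n)
    (g' := fun n y => c n * (n * y ^ (n - 1))) (t := Metric.ball 0 r) (y₀ := 0) hu Metric.isOpen_ball
    (convex_ball _ _).isPreconnected (fun n y _ => ?_) (fun n y hy => ?_)
    (Metric.mem_ball_self hr0) (summable_of_norm_le hc (by simp)) (by simpa using hzr)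
  · exact (hasDerivAt_pow n y).const_mul (c n)
  · have hy' : ‖y‖ ≤ r := by simpa using (Metric.mem_ball.1 hy).le
    rw [norm_mul, norm_mul, norm_pow, Complex.norm_natCast]
    gcongr
    exact hc n

/-- Termwise application of `z d/dz` to a power series. -/
theorem hasDerivAt_powSum_euler {a c : ℕ → ℂ} {C : ℝ} (hc : ∀ n, ‖c n‖ ≤ C)
    (hac : ∀ n, a n = n * c n) {z : ℂ} (hz : ‖z‖ < 1) (hz0 : z ≠ 0) :
    HasDerivAt (powSum c) (powSum a z / z) z := by
  convert hasDerivAt_powSum hc hz using 1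
  rw [powSum, ← tsum_div_const]
  refine tsum_congr fun n => ?_
  rcases n with _ | n
  · simp [hac]
  · rw [hac, Nat.add_sub_cancel, pow_succ]; field_simp

/-- The strict partial sums obey `A_0 = 0` and `A_{n+1} = A_n + a_n`, so their series `P` satisfies
`P = z P + z * powSum a z`. -/
theorem powSum_cumulative {a : ℕ → ℂ} {C : ℝ} (ha : ∀ n, ‖a n‖ ≤ C) {z : ℂ} (hz : ‖z‖ < 1) :
    powSum (fun n => ∑ k ∈ Finset.range n, a k) z = z / (1 - z) * powSum a z := by
  have h1z : 1 - z ≠ 0 := by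
    intro h
    rw [← sub_eq_zero.1 h, norm_one] at hz
    exact lt_irrefl _ hz
  have hC : 0 ≤ C := (norm_nonneg _).trans (ha 0)
  have hA : ∀ n : ℕ, ‖∑ k ∈ Finset.range n, a k‖ ≤ C * (n + 1) := fun n => by
    calc ‖∑ k ∈ Finset.range n, a k‖ ≤ ∑ k ∈ Finset.range n, C :=
          norm_sum_le_of_le _ fun k _ => ha k
      _ = C * n := by simp [mul_comm]
      _ ≤ _ := by gcongr; linarith
  have hs := summable_of_norm_le_linear hA hz
  have hs' := summable_of_norm_le ha hz
  have key : powSum (fun n => ∑ k ∈ Finset.range n, a k) z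
      = z * powSum (fun n => ∑ k ∈ Finset.range n, a k) z + z * powSum a z := by
    conv_lhs => rw [powSum, hs.tsum_eq_zero_add]
    rw [powSum, powSum, ← tsum_mul_left, ← tsum_mul_left,
      ← (hs.mul_left z).tsum_add (hs'.mul_left z)]
    simp only [Finset.range_zero, Finset.sum_empty, zero_mul, zero_add]
    refine tsum_congr fun n => ?_
    rw [Finset.sum_range_succ]; ring
  field_simp
  linear_combination key

theorem powSum_mul_pow (a : ℕ → ℂ) (x z : ℂ) :
    powSum (fun n => a n * x ^ n) z = powSum a (x * z) := by
  simp only [powSum, mul_pow, mul_assoc]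

/-! ### Limits of power series at the unit circle -/

/-- The path `1 - ε + i ε`, which approaches `1` inside a Stolz cone. -/
noncomputable def stolzPath (ε : ℝ) : ℂ := 1 - ε + ε * Complex.I

theorem stolzPath_re (ε : ℝ) : (stolzPath ε).re = 1 - ε := by simp [stolzPath]

theorem stolzPath_im (ε : ℝ) : (stolzPath ε).im = ε := by simp [stolzPath]

theorem norm_stolzPath_le {ε : ℝ} (h0 : 0 < ε) (h1 : ε < 1 / 2) :
    ‖stolzPath ε‖ ≤ 1 - ε / 2 := by
  rw [← abs_of_nonneg (by linarith : 0 ≤ 1 - ε / 2)]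
  refine abs_le_of_sq_le_sq' ?_ (abs_nonneg _) |>.2
  rw [sq_abs, Complex.sq_norm, Complex.normSq_apply, stolzPath_re, stolzPath_im]
  nlinarith

theorem eventually_pos_lt_half : ∀ᶠ ε : ℝ in 𝓝[>] 0, 0 < ε ∧ ε < 1 / 2 :=
  Ioo_mem_nhdsGT (by norm_num)

theorem tendsto_stolzPath : Tendsto stolzPath (𝓝[>] 0) (𝓝 1) := by
  have : Continuous stolzPath := by unfold stolzPath; fun_prop
  simpa [stolzPath] using (this.tendsto 0).mono_left nhdsWithin_le_nhds

/-- The series `∑ a n` converges (in order of summation) to `l`. -/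
def SeriesTendsto (a : ℕ → ℂ) (l : ℂ) : Prop :=
  Tendsto (fun N => ∑ n ∈ Finset.range N, a n) atTop (𝓝 l)

theorem SeriesTendsto.powSum_stolzPath {a : ℕ → ℂ} {l : ℂ} (h : SeriesTendsto a l) :
    Tendsto (fun ε : ℝ => powSum a (stolzPath ε)) (𝓝[>] 0) (𝓝 l) := by
  -- On the path `|Im|` and `1 - Re` both equal `ε`, so any cone slope above `1` would do.
  refine (Complex.tendsto_tsum_powerSeries_nhdsWithin_stolzCone h (s := 2) two_pos).comp ?_
  refine tendsto_nhdsWithin_of_tendsto_nhds_of_eventually_within _ tendsto_stolzPath ?_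
  filter_upwards [eventually_pos_lt_half] with ε hε
  simp only [Complex.stolzCone, Set.mem_ofPred_eq, stolzPath_re, stolzPath_im, abs_of_pos hε.1]
  linarith [hε.1]

/-- If the coefficients tend to zero, the power series is `o(1 / ε)` at distance of order `ε`
from the unit circle. -/
theorem tendsto_mul_powSum_zero {a : ℕ → ℂ} (ha : Tendsto a atTop (𝓝 0)) {w : ℝ → ℂ} {c : ℝ}
    (hc : 0 < c) (hw : ∀ᶠ ε : ℝ in 𝓝[>] 0, ‖w ε‖ ≤ 1 - c * ε) :
    Tendsto (fun ε : ℝ => (ε : ℂ) * powSum a (w ε)) (𝓝[>] 0) (𝓝 0) := by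
  rw [Metric.tendsto_nhds]
  intro η hη
  have hη' : 0 < η * c / 2 := by positivity
  obtain ⟨N, hN⟩ := (Metric.tendsto_atTop.1 ha) _ hη'
  set B := ∑ n ∈ Finset.range N, ‖a n‖ with hB
  have hB0 : 0 ≤ B := Finset.sum_nonneg fun _ _ => norm_nonneg _
  have hsmall : ∀ᶠ ε : ℝ in 𝓝[>] 0, ε < η / (2 * (B + 1)) :=
    nhdsWithin_le_nhds (Iio_mem_nhds (by positivity))
  filter_upwards [hw, hsmall, self_mem_nhdsWithin] with ε h1 h2 h3
  have hε : 0 < ε := h3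
  set ρ := ‖w ε‖
  have hρ0 : 0 ≤ ρ := norm_nonneg _
  have hρ : ρ < 1 := by nlinarith [mul_pos hc hε]
  -- The first `N` terms contribute at most the constant `B`. The rest is at most `η c / 2` times a
  -- geometric series whose sum is at most `1 / (c ε)`.
  have hterm : ∀ n, ‖a n * w ε ^ n‖ ≤
      (if n ∈ Finset.range N then ‖a n‖ else 0) + η * c / 2 * ρ ^ n := fun n => by
    rw [norm_mul, norm_pow]
    have hp : ρ ^ n ≤ 1 := pow_le_one₀ hρ0 hρ.le
    have hp0 : 0 ≤ ρ ^ n := pow_nonneg hρ0 n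
    split_ifs with hn
    · nlinarith [norm_nonneg (a n), mul_nonneg hη'.le hp0]
    · have := hN n (by simpa using hn)
      rw [dist_zero_right] at this
      rw [zero_add]
      gcongr
  have hsum : HasSum (fun n => (if n ∈ Finset.range N then ‖a n‖ else 0) + η * c / 2 * ρ ^ n)
      (B + η * c / 2 * (1 - ρ)⁻¹) := by
    refine HasSum.add ?_ ((hasSum_geometric_of_lt_one hρ0 hρ).mul_left _)
    rw [hB, ← Finset.sum_congr rfl fun n hn => if_pos hn]
    exact hasSum_sum_of_ne_finset_zero fun n hn => if_neg hn
  have hle : ‖powSum a (w ε)‖ ≤ B + η * c / 2 * (1 - ρ)⁻¹ := tsum_of_norm_bounded hsum hterm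
  have hinv : (1 - ρ)⁻¹ ≤ (c * ε)⁻¹ := by
    apply inv_anti₀ (by positivity); linarith
  rw [dist_zero_right, norm_mul, Complex.norm_real, Real.norm_of_nonneg hε.le]
  have h4 : ε * B < η / 2 := by
    rw [lt_div_iff₀ (by positivity)] at h2
    nlinarith
  calc ε * ‖powSum a (w ε)‖ ≤ ε * (B + η * c / 2 * (c * ε)⁻¹) := by
        gcongr
        exact hle.trans (by gcongr)
    _ = ε * B + η / 2 := by field_simp
    _ < η := by linarith

theorem tendsto_powSum_of_summable {a : ℕ → ℂ} (ha : Summable fun n => ‖a n‖) {w : ℝ → ℂ} {w₀ : ℂ}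
    (hw : ∀ᶠ ε : ℝ in 𝓝[>] 0, ‖w ε‖ ≤ 1) (hlim : Tendsto w (𝓝[>] 0) (𝓝 w₀)) :
    Tendsto (fun ε => powSum a (w ε)) (𝓝[>] 0) (𝓝 (powSum a w₀)) := by
  refine tendsto_tsum_of_dominated_convergence ha (fun n => (hlim.pow n).const_mul _) ?_
  filter_upwards [hw] with ε hε n
  rw [norm_mul, norm_pow]
  exact mul_le_of_le_one_right (norm_nonneg _) (pow_le_one₀ (norm_nonneg _) hε)

/-- A function with bounded derivative near `0⁺` and limit `0` at `0⁺` is `O(ε)`. -/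
theorem exists_norm_le_mul_of_hasDerivAt {g g' : ℝ → ℂ} {C : ℝ}
    (hg : ∀ᶠ ε : ℝ in 𝓝[>] 0, HasDerivAt g (g' ε) ε)
    (hC : ∀ᶠ ε : ℝ in 𝓝[>] 0, ‖g' ε‖ ≤ C) (h0 : Tendsto g (𝓝[>] 0) (𝓝 0)) :
    ∀ᶠ ε : ℝ in 𝓝[>] 0, ‖g ε‖ ≤ C * ε := by
  obtain ⟨δ, hδ, hsub⟩ := mem_nhdsGT_iff_exists_Ioo_subset.1 (hg.and hC)
  have hδ' : (0 : ℝ) < δ := hδ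
  filter_upwards [Ioo_mem_nhdsGT hδ'] with ε hε
  have hlim : Tendsto (fun η => ‖g ε - g η‖) (𝓝[>] 0) (𝓝 ‖g ε - 0‖) :=
    (tendsto_const_nhds.sub h0).norm
  rw [sub_zero] at hlim
  refine le_of_tendsto hlim ?_
  have hC0 : 0 ≤ C := (norm_nonneg _).trans (hsub hε).2
  filter_upwards [Ioo_mem_nhdsGT hε.1] with η hη
  have := (convex_Ioo (0 : ℝ) δ).norm_image_sub_le_of_norm_hasDerivWithin_le (f := g) (f' := g')
    (C := C) (fun x hx => (hsub hx).1.hasDerivWithinAt) (fun x hx => (hsub hx).2)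
    (⟨hη.1, hη.2.trans hε.2⟩ : η ∈ Set.Ioo 0 δ) hε
  refine this.trans ?_
  rw [Real.norm_of_nonneg (by linarith [hη.2])]
  gcongr
  linarith [hη.1]

/-! ### Nested sums and convergence of polylogarithm series -/

/-- The largest index `a` is split off; the others then range strictly below it, which is the
truncation at `a - 1`. -/
theorem sum_decreasingTuples_succ {R : Type*} [CommSemiring R] (r N : ℕ)
    (g : Fin (r + 1) → ℕ → R) :
    ∑ n ∈ decreasingTuples (r + 1) N, ∏ j, g j (n j) =
      ∑ a ∈ Finset.Icc 1 N, g 0 a *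
        ∑ n ∈ decreasingTuples r (a - 1), ∏ j : Fin r, g j.succ (n j) := by
  simp_rw [Finset.mul_sum]
  rw [Finset.sum_sigma']
  refine Finset.sum_bij' (fun n _ => ⟨n 0, Fin.tail n⟩)
    (fun x _ => (Fin.cons x.1 x.2 : Fin (r + 1) → ℕ)) ?_ ?_ ?_ ?_ ?_
  · intro n hn
    simp only [decreasingTuples, Finset.mem_filter, Fintype.mem_piFinset, Finset.mem_Icc,
      Finset.mem_sigma, Fin.tail] at hn ⊢
    refine ⟨hn.1 0, fun j => ⟨(hn.1 _).1, ?_⟩, fun i j hij => hn.2 _ _ (Fin.succ_lt_succ_iff.2 hij)⟩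
    have := hn.2 0 j.succ (Fin.succ_pos j)
    omega
  · rintro ⟨a, v⟩ hx
    simp only [decreasingTuples, Finset.mem_filter, Fintype.mem_piFinset, Finset.mem_Icc,
      Finset.mem_sigma] at hx ⊢
    refine ⟨fun j => ?_, fun i j hij => ?_⟩
    · refine Fin.cases ?_ (fun j => ?_) j
      · simpa using hx.1
      · have := hx.2.1 j
        simp only [Fin.cons_succ]
        omega
    · induction j using Fin.cases with
      | zero => exact absurd hij (Fin.not_lt_zero _)
      | succ j =>
        induction i using Fin.cases with
        | zero =>
          have := hx.2.1 j
          simp only [Fin.cons_succ, Fin.cons_zero]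
          omega
        | succ i => simpa using hx.2.2 i j (Fin.succ_lt_succ_iff.1 hij)
  · intro n _; exact Fin.cons_self_tail n
  · rintro ⟨a, v⟩ _; simp
  · intro n _
    rw [Fin.prod_univ_succ]; rfl

theorem sum_decreasingTuples_zero {R : Type*} [CommSemiring R] (N : ℕ) (g : Fin 0 → ℕ → R) :
    ∑ n ∈ decreasingTuples 0 N, ∏ j, g j (n j) = 1 := by
  have : decreasingTuples 0 N = Finset.univ := by
    ext n
    simp [decreasingTuples]
  simp [this]

theorem sum_Icc_one_eq_sum_range {R : Type*} [AddCommMonoid R] {f : ℕ → R} (h0 : f 0 = 0) (N : ℕ) :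
    ∑ n ∈ Finset.Icc 1 N, f n = ∑ n ∈ Finset.range (N + 1), f n := by
  rw [Finset.sum_range_eq_add_Ico _ (Nat.succ_pos N), h0, zero_add]
  rfl

/-- The terms of the series of `Li_p(x)`. -/
noncomputable def polylogCoeff (p : ℕ) (x : ℂ) (n : ℕ) : ℂ := x ^ n / (n : ℂ) ^ p

/-- The terms of the series of `Li_{p,q}(x,y)`. -/
noncomputable def doubleCoeff (p q : ℕ) (x y : ℂ) (n : ℕ) : ℂ :=
  polylogCoeff p x n * ∑ k ∈ Finset.range n, polylogCoeff q y k

/-- Division by zero gives `0`, so for positive weight the index `0` is harmless and sums may run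
over `Finset.range`. -/
theorem polylogCoeff_zero {p : ℕ} (hp : 1 ≤ p) (x : ℂ) : polylogCoeff p x 0 = 0 := by
  simp [polylogCoeff, Nat.one_le_iff_ne_zero.1 hp]

theorem polylogPartial_one_eq {p : ℕ} (hp : 1 ≤ p) (x : ℂ) (N : ℕ) :
    polylogPartial ![p] ![x] N = ∑ n ∈ Finset.range (N + 1), polylogCoeff p x n := by
  rw [polylogPartial, sum_decreasingTuples_succ 0 N
    (fun j n => (![x] : Fin 1 → ℂ) j ^ n / (n : ℂ) ^ (![p] : Fin 1 → ℕ) j)]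
  simp_rw [sum_decreasingTuples_zero _ (fun (j : Fin 0) n =>
    (![x] : Fin 1 → ℂ) j.succ ^ n / (n : ℂ) ^ (![p] : Fin 1 → ℕ) j.succ)]
  rw [← sum_Icc_one_eq_sum_range (polylogCoeff_zero hp x)]
  simp [polylogCoeff]

theorem polylogPartial_two_eq {p q : ℕ} (hq : 1 ≤ q) (x y : ℂ) (N : ℕ) :
    polylogPartial ![p, q] ![x, y] N = ∑ n ∈ Finset.range (N + 1), doubleCoeff p q x y n := by
  rw [polylogPartial, sum_decreasingTuples_succ 1 N
    (fun j n => (![x, y] : Fin 2 → ℂ) j ^ n / (n : ℂ) ^ (![p, q] : Fin 2 → ℕ) j)]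
  rw [← sum_Icc_one_eq_sum_range (by simp [doubleCoeff])]
  refine Finset.sum_congr rfl fun n hn => ?_
  have hn1 : n - 1 + 1 = n := Nat.sub_add_cancel (Finset.mem_Icc.1 hn).1
  have h := polylogPartial_one_eq hq y (n - 1)
  rw [hn1] at h
  rw [doubleCoeff, ← h]
  rfl

theorem SeriesTendsto.comp_succ {a : ℕ → ℂ} {l : ℂ} (h : SeriesTendsto a l) :
    Tendsto (fun N => ∑ n ∈ Finset.range (N + 1), a n) atTop (𝓝 l) :=
  (tendsto_add_atTop_iff_nat 1).2 h

theorem SeriesTendsto.polylog_one {p : ℕ} (hp : 1 ≤ p) {x l : ℂ}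
    (h : SeriesTendsto (polylogCoeff p x) l) :
    Tendsto (polylogPartial ![p] ![x]) atTop (𝓝 l) ∧ polylog ![p] ![x] = l := by
  have : Tendsto (polylogPartial ![p] ![x]) atTop (𝓝 l) := by
    rw [funext (polylogPartial_one_eq hp x)]; exact h.comp_succ
  exact ⟨this, this.limUnder_eq⟩

theorem SeriesTendsto.polylog_two {p q : ℕ} (hq : 1 ≤ q) {x y l : ℂ}
    (h : SeriesTendsto (doubleCoeff p q x y) l) :
    Tendsto (polylogPartial ![p, q] ![x, y]) atTop (𝓝 l) ∧ polylog ![p, q] ![x, y] = l := by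
  have : Tendsto (polylogPartial ![p, q] ![x, y]) atTop (𝓝 l) := by
    rw [funext (polylogPartial_two_eq hq x y)]; exact h.comp_succ
  exact ⟨this, this.limUnder_eq⟩

theorem norm_polylogCoeff_le_inv_pow (p : ℕ) {x : ℂ} (hx : ‖x‖ ≤ 1) (n : ℕ) :
    ‖polylogCoeff p x n‖ ≤ ((n : ℝ) ^ p)⁻¹ := by
  rw [polylogCoeff, norm_div, norm_pow, norm_pow, Complex.norm_natCast, div_eq_mul_inv]
  exact mul_le_of_le_one_left (by positivity) (pow_le_one₀ (norm_nonneg _) hx)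

theorem norm_polylogCoeff_le_one (p : ℕ) {x : ℂ} (hx : ‖x‖ ≤ 1) (n : ℕ) :
    ‖polylogCoeff p x n‖ ≤ 1 := by
  refine (norm_polylogCoeff_le_inv_pow p hx n).trans ?_
  rcases n with _ | n
  · rcases p with _ | p <;> simp
  · apply inv_le_one_of_one_le₀
    apply one_le_pow₀
    simp

theorem Summable.seriesTendsto {a : ℕ → ℂ} (h : Summable a) : SeriesTendsto a (∑' n, a n) :=
  h.hasSum.tendsto_sum_nat

/-- Convergence is absolute for `p ≥ 2`. Otherwise Dirichlet's test applies, the geometric sums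
being bounded by `2 / ‖x - 1‖`. -/
theorem exists_seriesTendsto_polylogCoeff {p : ℕ} {x : ℂ} (hx : ‖x‖ ≤ 1)
    (h : 2 ≤ p ∨ 1 ≤ p ∧ x ≠ 1) : ∃ l, SeriesTendsto (polylogCoeff p x) l := by
  rcases h with hp | ⟨hp, hx1⟩
  · refine ⟨_, Summable.seriesTendsto (Summable.of_norm_bounded ?_
      (norm_polylogCoeff_le_inv_pow p hx))⟩
    exact Real.summable_nat_pow_inv.2 hp
  · have hanti : Antitone fun n : ℕ => (((n : ℝ) + 1) ^ p)⁻¹ := fun a b hab => by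
      simp only
      gcongr
    have hzero : Tendsto (fun n : ℕ => (((n : ℝ) + 1) ^ p)⁻¹) atTop (𝓝 0) := by
      have h1 : Tendsto (fun n : ℕ => (n : ℝ) + 1) atTop atTop :=
        tendsto_atTop_add_const_right _ _ tendsto_natCast_atTop_atTop
      exact tendsto_inv_atTop_zero.comp
        ((tendsto_pow_atTop (Nat.one_le_iff_ne_zero.1 hp)).comp h1)
    have hb : ∀ n, ‖∑ i ∈ Finset.range n, x ^ i‖ ≤ 2 / ‖x - 1‖ := fun n => by
      rw [geom_sum_eq hx1, norm_div]
      gcongr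
      calc ‖x ^ n - 1‖ ≤ ‖x ^ n‖ + ‖(1 : ℂ)‖ := norm_sub_le _ _
        _ ≤ 1 + 1 := by
          rw [norm_pow, norm_one]
          gcongr
          exact pow_le_one₀ (norm_nonneg _) hx
        _ = 2 := by norm_num
    obtain ⟨l, hl⟩ := cauchySeq_tendsto_of_complete
      (hanti.cauchySeq_series_mul_of_tendsto_zero_of_bounded hzero hb)
    refine ⟨x * l, (tendsto_add_atTop_iff_nat 1).1 ((hl.const_mul x).congr fun N => ?_)⟩
    rw [Finset.sum_range_succ', polylogCoeff_zero hp, add_zero, Finset.mul_sum]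
    refine Finset.sum_congr rfl fun n _ => ?_
    rw [polylogCoeff, Complex.real_smul]
    push_cast
    rw [pow_succ]
    field_simp

theorem seriesTendsto_polylog {p : ℕ} {x : ℂ} (hx : ‖x‖ ≤ 1)
    (h : 2 ≤ p ∨ 1 ≤ p ∧ x ≠ 1) : SeriesTendsto (polylogCoeff p x) (polylog ![p] ![x]) := by
  obtain ⟨l, hl⟩ := exists_seriesTendsto_polylogCoeff hx h
  rwa [(hl.polylog_one (by omega)).2]

/-- Telescoping of `1 / √(n+1) ≤ 2√(n+1) - 2√n`. This square-root growth stands in for finer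
logarithmic estimates throughout. -/
theorem sum_inv_sqrt_succ_le (n : ℕ) :
    ∑ k ∈ Finset.range (n + 1), (√(k : ℝ))⁻¹ ≤ 2 * √(n : ℝ) := by
  induction n with
  | zero => simp
  | succ n ih =>
    rw [Finset.sum_range_succ]
    have h1 : √(n : ℝ) ^ 2 = n := Real.sq_sqrt (Nat.cast_nonneg n)
    have h2 : √((n + 1 : ℕ) : ℝ) ^ 2 = n + 1 := by
      rw [Real.sq_sqrt (Nat.cast_nonneg _)]; push_cast; ring
    have h3 : 0 < √((n + 1 : ℕ) : ℝ) := Real.sqrt_pos.2 (by positivity)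
    have h4 : (√((n + 1 : ℕ) : ℝ))⁻¹ ≤ 2 * √((n + 1 : ℕ) : ℝ) - 2 * √(n : ℝ) := by
      rw [inv_le_iff_one_le_mul₀ h3]
      nlinarith [sq_nonneg (√((n + 1 : ℕ) : ℝ) - √(n : ℝ))]
    linarith

theorem sum_inv_sqrt_le (n : ℕ) : ∑ k ∈ Finset.range n, (√(k : ℝ))⁻¹ ≤ 2 * √(n : ℝ) := by
  refine (Finset.sum_le_sum_of_subset_of_nonneg (Finset.range_mono (Nat.le_succ n))
    fun _ _ _ => by positivity).trans (sum_inv_sqrt_succ_le n)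

/-- The remainder `∑_{k ≥ n} y ^ k / k ^ q` of the series of `Li_q(y)`. -/
noncomputable def polylogTail (q : ℕ) (y : ℂ) (n : ℕ) : ℂ :=
  polylog ![q] ![y] - ∑ k ∈ Finset.range n, polylogCoeff q y k

theorem norm_polylogTail_le {q : ℕ} (hq : 2 ≤ q) {y : ℂ} (hy : ‖y‖ ≤ 1) {n : ℕ} (hn : 1 ≤ n) :
    ‖polylogTail q y n‖ ≤ 2 / n := by
  have hlim := ((seriesTendsto_polylog hy (Or.inl hq)).sub_const
    (∑ k ∈ Finset.range n, polylogCoeff q y k)).norm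
  refine le_of_tendsto hlim ?_
  filter_upwards [eventually_ge_atTop n] with N hN
  rw [← Finset.sum_Ico_eq_sub _ hN]
  calc ‖∑ k ∈ Finset.Ico n N, polylogCoeff q y k‖
      ≤ ∑ k ∈ Finset.Ico n N, (((k : ℝ)) ^ 2)⁻¹ := by
        refine norm_sum_le_of_le _ fun k hk => (norm_polylogCoeff_le_inv_pow q hy k).trans ?_
        have hk1 : (1 : ℝ) ≤ k := by
          exact_mod_cast hn.trans (Finset.mem_Ico.1 hk).1
        gcongr
    _ = ∑ k ∈ Finset.Ioo (n - 1) N, ((k : ℝ) ^ 2)⁻¹ := by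
        refine Finset.sum_congr ?_ fun _ _ => rfl
        ext k
        simp only [Finset.mem_Ico, Finset.mem_Ioo]
        omega
    _ ≤ 2 / ((n - 1 : ℕ) + 1) := sum_Ioo_inv_sq_le _ _
    _ = 2 / n := by
        rw [Nat.cast_sub hn]; simp

theorem summable_norm_polylogTail_div {q : ℕ} (hq : 2 ≤ q) {y : ℂ} (hy : ‖y‖ ≤ 1) :
    Summable fun n => ‖polylogTail q y n / (n : ℂ)‖ := by
  refine Summable.of_nonneg_of_le (fun _ => norm_nonneg _) (fun n => ?_)
    ((Real.summable_nat_pow_inv.2 (le_refl 2)).mul_left 2)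
  rcases Nat.eq_zero_or_pos n with rfl | hn
  · simp
  · rw [norm_div, Complex.norm_natCast]
    have hn' : (0 : ℝ) < n := by exact_mod_cast hn
    calc ‖polylogTail q y n‖ / n ≤ 2 / n / n := by gcongr; exact norm_polylogTail_le hq hy hn
      _ = _ := by field_simp

/-- Writing the inner sum as `Li_q(y)` minus its tail splits the series into a multiple of that of
`Li_1(x)`, which converges because `x ≠ 1`, and one that converges absolutely. -/
theorem exists_seriesTendsto_doubleCoeff_one {q : ℕ} (hq : 2 ≤ q) {x y : ℂ} (hx : ‖x‖ ≤ 1)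
    (hx1 : x ≠ 1) (hy : ‖y‖ ≤ 1) : ∃ l, SeriesTendsto (doubleCoeff 1 q x y) l := by
  have h1 := (seriesTendsto_polylog hx (Or.inr ⟨le_refl 1, hx1⟩)).mul_const (polylog ![q] ![y])
  have hs : Summable fun n => x ^ n * (polylogTail q y n / (n : ℂ)) := by
    refine Summable.of_norm_bounded (summable_norm_polylogTail_div hq hy) fun n => ?_
    rw [norm_mul, norm_pow]
    exact mul_le_of_le_one_left (norm_nonneg _) (pow_le_one₀ (norm_nonneg _) hx)
  refine ⟨_, (h1.sub hs.seriesTendsto).congr fun N => ?_⟩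
  rw [Finset.sum_mul, ← Finset.sum_sub_distrib]
  refine Finset.sum_congr rfl fun n _ => ?_
  rw [doubleCoeff, polylogTail, polylogCoeff]
  ring

theorem sum_range_div_eq_summation_by_parts (a : ℕ → ℂ) (N : ℕ) :
    ∑ n ∈ Finset.range N, (∑ k ∈ Finset.range n, a k) / (n : ℂ) =
      (∑ n ∈ Finset.range N, polylogCoeff 1 1 n) * ∑ k ∈ Finset.range N, a k -
        ∑ k ∈ Finset.range N, a k * ∑ n ∈ Finset.range (k + 1), polylogCoeff 1 1 n := by
  induction N with
  | zero => simp
  | succ N ih =>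
    simp only [Finset.sum_range_succ] at ih ⊢
    rw [ih]
    simp only [polylogCoeff, one_pow, pow_one]
    ring

theorem tendsto_harmonic_mul_polylogTail {q : ℕ} (hq : 2 ≤ q) {y : ℂ} (hy : ‖y‖ ≤ 1) :
    Tendsto (fun N => (∑ n ∈ Finset.range N, polylogCoeff 1 1 n) * polylogTail q y N) atTop
      (𝓝 0) := by
  have hlim : Tendsto (fun N : ℕ => 4 * (√(N : ℝ))⁻¹) atTop (𝓝 0) := by
    simpa using (tendsto_inv_atTop_zero.comp
      (Real.tendsto_sqrt_atTop.comp tendsto_natCast_atTop_atTop)).const_mul (4 : ℝ)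
  refine squeeze_zero_norm' ?_ hlim
  filter_upwards [eventually_ge_atTop 1] with N hN
  have hN' : (0 : ℝ) < N := by exact_mod_cast hN
  have h1 : ‖∑ n ∈ Finset.range N, polylogCoeff 1 1 n‖ ≤ 2 * √(N : ℝ) := by
    refine (norm_sum_le_of_le _ fun n _ => ?_).trans (sum_inv_sqrt_le N)
    refine (norm_polylogCoeff_le_inv_pow 1 (by simp) n).trans ?_
    rw [pow_one]
    rcases Nat.eq_zero_or_pos n with rfl | hn
    · simp
    · have hn' : (1 : ℝ) ≤ n := by exact_mod_cast hn
      apply inv_anti₀ (Real.sqrt_pos.2 (by linarith))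
      exact Real.sqrt_le_iff.2 ⟨by linarith, by nlinarith⟩
  rw [norm_mul]
  calc _ ≤ 2 * √(N : ℝ) * (2 / N) := by
        gcongr
        exact norm_polylogTail_le hq hy hN
    _ = 4 * (√(N : ℝ))⁻¹ := by
        nth_rewrite 2 [← Real.mul_self_sqrt hN'.le]
        field_simp
        norm_num

/-- Summation by parts exchanges the two summations. The boundary term is a harmonic sum times a
tail and vanishes in the limit; the harmonic sums up to and including `k` produce the diagonal term
`Li_{q+1}(y)`. -/
theorem seriesTendsto_doubleCoeff_of_tail {q : ℕ} (hq : 2 ≤ q) {y : ℂ} (hy : ‖y‖ ≤ 1) :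
    SeriesTendsto (doubleCoeff q 1 y 1)
      ((∑' n : ℕ, polylogTail q y n / (n : ℂ)) - polylog ![q + 1] ![y]) := by
  have h1 := (summable_norm_polylogTail_div hq hy).of_norm.seriesTendsto
  have h2 := seriesTendsto_polylog (p := q + 1) hy (Or.inl (by omega))
  have h3 := (h1.sub (tendsto_harmonic_mul_polylogTail hq hy)).sub h2
  rw [sub_zero] at h3
  refine h3.congr fun N => ?_
  have h4 := sum_range_div_eq_summation_by_parts (polylogCoeff q y) N
  simp only [polylogTail, sub_div, Finset.sum_sub_distrib] at *
  rw [h4]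
  have h5 : ∑ n ∈ Finset.range N, polylog ![q] ![y] / (n : ℂ) =
      (∑ n ∈ Finset.range N, polylogCoeff 1 1 n) * polylog ![q] ![y] := by
    rw [Finset.sum_mul]
    refine Finset.sum_congr rfl fun n _ => ?_
    simp only [polylogCoeff, one_pow, pow_one]; ring
  have h6 : ∑ k ∈ Finset.range N, polylogCoeff q y k *
      ∑ n ∈ Finset.range (k + 1), polylogCoeff 1 1 n =
      ∑ k ∈ Finset.range N, doubleCoeff q 1 y 1 k +
        ∑ k ∈ Finset.range N, polylogCoeff (q + 1) y k := by
    rw [← Finset.sum_add_distrib]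
    refine Finset.sum_congr rfl fun n _ => ?_
    rw [Finset.sum_range_succ, doubleCoeff, mul_add]
    congr 1
    simp only [polylogCoeff, one_pow, pow_one, pow_succ (n : ℂ) q]
    ring
  rw [h5, h6]
  ring

/-- The sum of the tails: a regularised form of the stuffle relation. -/
theorem tsum_polylogTail_div {q : ℕ} (hq : 2 ≤ q) {y : ℂ} (hy : ‖y‖ ≤ 1) :
    ∑' n : ℕ, polylogTail q y n / (n : ℂ) = polylog ![q, 1] ![y, 1] + polylog ![q + 1] ![y] := by
  rw [((seriesTendsto_doubleCoeff_of_tail hq hy).polylog_two le_rfl).2]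
  ring

theorem seriesTendsto_double_one {q : ℕ} (hq : 2 ≤ q) {x y : ℂ} (hx : ‖x‖ ≤ 1)
    (hx1 : x ≠ 1) (hy : ‖y‖ ≤ 1) :
    SeriesTendsto (doubleCoeff 1 q x y) (polylog ![1, q] ![x, y]) := by
  obtain ⟨l, hl⟩ := exists_seriesTendsto_doubleCoeff_one hq hx hx1 hy
  rwa [(hl.polylog_two (by omega)).2]

theorem norm_doubleCoeff_one_le {q : ℕ} {x y : ℂ} (hx : ‖x‖ ≤ 1) (hy : ‖y‖ ≤ 1) (n : ℕ) :
    ‖doubleCoeff 1 q x y n‖ ≤ 1 := by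
  rw [doubleCoeff, norm_mul]
  have h1 : ‖∑ k ∈ Finset.range n, polylogCoeff q y k‖ ≤ n := by
    refine (norm_sum_le_of_le _ fun k _ => norm_polylogCoeff_le_one q hy k).trans ?_
    simp
  calc _ ≤ ((n : ℝ) ^ 1)⁻¹ * n := by
        gcongr
        exact norm_polylogCoeff_le_inv_pow 1 hx n
    _ ≤ 1 := by
        rw [pow_one]
        exact inv_mul_le_one

/-! ### The `S` value as a power series at `i` -/

/-- One factor of the terms of an alternating multiple mixed value. -/
noncomputable def mixedFactor (ε σ : ℤˣ) (s n : ℕ) : ℂ :=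
  (1 + ((ε : ℤ) : ℂ) * (-1) ^ n) *
    (((σ ^ ((2 * (n : ℤ) + 1 - (ε : ℤ)) / 4) : ℤˣ) : ℤ) : ℂ) / (n : ℂ) ^ s

theorem ofReal_mixedPartial {r : ℕ} (ε σ : Fin r → ℤˣ) (s : Fin r → ℕ) (N : ℕ) :
    ((mixedPartial ε σ s N : ℝ) : ℂ) =
      ∑ n ∈ decreasingTuples r N, ∏ j : Fin r, mixedFactor (ε j) (σ j) (s j) (n j) := by
  simp only [mixedPartial, mixedFactor]
  push_cast
  rfl

/-- The sums of the parity-alternating products `1 / (n₁ ⋯ n_{q+1})` with largest index `n`,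
the smallest index being even and carrying a sign. -/
noncomputable def altCoeff : ℕ → ℕ → ℂ
  | 0, n => (Complex.I ^ n + (-Complex.I) ^ n) / n
  | q + 1, n => (1 + (-1) ^ (q + 1) * (-1) ^ n) / n * ∑ k ∈ Finset.range n, altCoeff q k

theorem altCoeff_zero_right (q : ℕ) : altCoeff q 0 = 0 := by
  cases q <;> simp [altCoeff]

/-- Parities are counted from the last index, so removing the first one does not disturb them. -/
theorem parityS_succ (r : ℕ) (j : Fin r) : parityS (r + 1) j.succ = parityS r j := by
  simp only [parityS, Fin.val_succ]
  congr 1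
  omega

/-- The sum `i ^ n + (-i) ^ n` encodes parity and sign together: it is `2 (-1) ^ (n/2)` for even `n`
and `0` for odd `n`. -/
theorem mixedFactor_one_neg_one (n : ℕ) : mixedFactor 1 (-1) 1 n = altCoeff 0 n := by
  rw [mixedFactor, altCoeff, pow_one]
  congr 1
  rcases Nat.even_or_odd' n with ⟨k, rfl | rfl⟩
  · have h : (2 * ((2 * k : ℕ) : ℤ) + 1 - ((1 : ℤˣ) : ℤ)) / 4 = (k : ℤ) := by
      push_cast; omega
    rw [h, zpow_natCast]
    simp only [pow_mul, Complex.I_sq, neg_sq]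
    push_cast
    simp
    ring
  · simp only [pow_succ, pow_mul]
    simp

theorem mixedFactor_sign_one (ε : ℤˣ) (s n : ℕ) :
    mixedFactor ε 1 s n = (1 + ((ε : ℤ) : ℂ) * (-1) ^ n) / (n : ℂ) ^ s := by
  simp [mixedFactor]

theorem sum_mixedFactor_eq_sum_altCoeff (q N : ℕ) :
    ∑ n ∈ decreasingTuples (q + 1) N, ∏ j : Fin (q + 1),
      mixedFactor (parityS (q + 1) j) (if j = Fin.last q then -1 else 1) 1 (n j) =
      ∑ n ∈ Finset.range (N + 1), altCoeff q n := by
  induction q generalizing N with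
  | zero =>
    rw [sum_decreasingTuples_succ 0 N (fun j n =>
      mixedFactor (parityS (0 + 1) j) (if j = Fin.last 0 then -1 else 1) 1 n)]
    rw [← sum_Icc_one_eq_sum_range (altCoeff_zero_right 0)]
    refine Finset.sum_congr rfl fun a _ => ?_
    rw [sum_decreasingTuples_zero _ (fun (j : Fin 0) n =>
      mixedFactor (parityS (0 + 1) j.succ) (if j.succ = Fin.last 0 then -1 else 1) 1 n), mul_one,
      ← mixedFactor_one_neg_one]
    rfl
  | succ q ih =>
    rw [sum_decreasingTuples_succ (q + 1) N (fun j n =>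
      mixedFactor (parityS (q + 1 + 1) j) (if j = Fin.last (q + 1) then -1 else 1) 1 n)]
    rw [← sum_Icc_one_eq_sum_range (altCoeff_zero_right (q + 1))]
    refine Finset.sum_congr rfl fun a ha => ?_
    have ha1 : a - 1 + 1 = a := Nat.sub_add_cancel (Finset.mem_Icc.1 ha).1
    have h := ih (a - 1)
    rw [ha1] at h
    rw [altCoeff, ← h]
    congr 1
    · rw [if_neg (by simp [Fin.ext_iff]), mixedFactor_sign_one]
      simp [parityS]
    · refine Finset.sum_congr rfl fun n _ => Finset.prod_congr rfl fun j _ => ?_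
      rw [parityS_succ, ← Fin.succ_last]
      simp only [Fin.succ_inj]

/-- On indices of the right parity the sign is `i ^ n` for even `m` and `i * i ^ n` for odd `m`;
this is the source of the prefactor and of the evaluation point `i`. -/
theorem mixedFactor_neg_one_two (m n : ℕ) :
    mixedFactor ((-1) ^ m) (-1) 2 n = (if Odd m then Complex.I else 1) * Complex.I ^ n *
      ((1 + (-1) ^ m * (-1) ^ n) / (n : ℂ)) / n := by
  have key : (1 + ((((-1) ^ m : ℤˣ) : ℤ) : ℂ) * (-1) ^ n) *
      ((((-1) ^ ((2 * (n : ℤ) + 1 - (((-1) ^ m : ℤˣ) : ℤ)) / 4) : ℤˣ) : ℤ) : ℂ) =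
      (if Odd m then Complex.I else 1) * Complex.I ^ n * (1 + (-1) ^ m * (-1) ^ n) := by
    rcases Nat.even_or_odd m with hm | hm
    · rw [if_neg (Nat.not_odd_iff_even.2 hm), hm.neg_one_pow, hm.neg_one_pow]
      rcases Nat.even_or_odd' n with ⟨k, rfl | rfl⟩
      · have h : (2 * ((2 * k : ℕ) : ℤ) + 1 - ((1 : ℤˣ) : ℤ)) / 4 = (k : ℤ) := by
          push_cast; omega
        rw [h, zpow_natCast]
        simp only [pow_mul, Complex.I_sq, neg_sq]
        push_cast
        simp
        ring
      · simp only [pow_succ, pow_mul]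
        simp
    · rw [if_pos hm, hm.neg_one_pow, hm.neg_one_pow]
      rcases Nat.even_or_odd' n with ⟨k, rfl | rfl⟩
      · simp [pow_mul]
      · have h : (2 * ((2 * k + 1 : ℕ) : ℤ) + 1 - ((-1 : ℤˣ) : ℤ)) / 4 = ((k + 1 : ℕ) : ℤ) := by
          push_cast; omega
        rw [h, zpow_natCast]
        have h2 : Complex.I * Complex.I ^ (2 * k + 1) = (-1) ^ (k + 1) := by
          rw [← pow_succ', ← Complex.I_sq, ← pow_mul]; rfl
        rw [h2]
        simp only [pow_succ, pow_mul]
        push_cast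
        simp
        ring
  rw [mixedFactor, key]
  ring

theorem ofReal_multSPartial {m : ℕ} (hm : 1 ≤ m) (N : ℕ) :
    ((multSPartial (signsBarBar m) (args21 m) N : ℝ) : ℂ) =
      (if Odd m then Complex.I else 1) *
        ∑ n ∈ Finset.range (N + 1), altCoeff m n / n * Complex.I ^ n := by
  obtain ⟨q, rfl⟩ := Nat.exists_eq_add_of_le' hm
  rw [multSPartial, ofReal_mixedPartial, sum_decreasingTuples_succ (q + 1) N (fun j n =>
    mixedFactor (parityS (q + 1 + 1) j) (signsBarBar (q + 1) j) (args21 (q + 1) j) n),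
    Finset.mul_sum, ← sum_Icc_one_eq_sum_range (by simp)]
  refine Finset.sum_congr rfl fun a ha => ?_
  have ha1 : a - 1 + 1 = a := Nat.sub_add_cancel (Finset.mem_Icc.1 ha).1
  have h := sum_mixedFactor_eq_sum_altCoeff q (a - 1)
  rw [ha1] at h
  have h1 : ∑ n ∈ decreasingTuples (q + 1) (a - 1), ∏ j : Fin (q + 1),
      mixedFactor (parityS (q + 1 + 1) j.succ) (signsBarBar (q + 1) j.succ)
        (args21 (q + 1) j.succ) (n j) = ∑ n ∈ Finset.range a, altCoeff q n := by
    rw [← h]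
    refine Finset.sum_congr rfl fun n _ => Finset.prod_congr rfl fun j _ => ?_
    rw [parityS_succ, signsBarBar, args21, ← Fin.succ_last]
    simp [Fin.succ_ne_zero]
  rw [h1]
  have h2 : parityS (q + 1 + 1) 0 = (-1) ^ (q + 1) := by simp [parityS]
  have h3 : signsBarBar (q + 1) 0 = -1 := by simp [signsBarBar]
  have h4 : args21 (q + 1) 0 = 2 := by simp [args21]
  rw [h2, h3, h4, mixedFactor_neg_one_two, altCoeff]
  ring

/-- The coefficients live on indices of the parity of `q`, so the generating function is even or odd
with `q`. -/
theorem altCoeff_mul_neg_one_pow (q n : ℕ) :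
    altCoeff q n * (-1) ^ n = (-1) ^ q * altCoeff q n := by
  have h1 : ((-1 : ℂ) ^ n) * (-1) ^ n = 1 := by rw [← mul_pow]; simp
  cases q with
  | zero =>
    have h2 : (Complex.I ^ n) * (-1) ^ n = (-Complex.I) ^ n := by rw [← mul_pow]; simp
    have h3 : ((-Complex.I) ^ n) * (-1) ^ n = Complex.I ^ n := by rw [← mul_pow]; simp
    rw [altCoeff]
    linear_combination (h2 + h3) / n
  | succ q =>
    have h4 : ((-1 : ℂ) ^ (q + 1)) * (-1) ^ (q + 1) = 1 := by rw [← mul_pow]; simp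
    rw [altCoeff]
    linear_combination ((-1) ^ (q + 1) * h1 - h4 * (-1) ^ n) / n *
      ∑ k ∈ Finset.range n, altCoeff q k

/-- If the coefficients are `O(n^{-1/2})`, their partial sums are `O(n^{1/2})`, and dividing by `n`
restores the bound. It suffices for coefficients tending to zero and for absolute convergence after
one more division by `n`. -/
theorem exists_norm_altCoeff_le (q : ℕ) :
    ∃ C : ℝ, 0 ≤ C ∧ ∀ n : ℕ, ‖altCoeff q n‖ ≤ C * (√(n : ℝ))⁻¹ := by
  induction q with
  | zero =>
    refine ⟨2, by norm_num, fun n => ?_⟩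
    rcases Nat.eq_zero_or_pos n with rfl | hn
    · simp [altCoeff]
    have hn' : (1 : ℝ) ≤ n := by exact_mod_cast hn
    rw [altCoeff, norm_div, Complex.norm_natCast, div_eq_mul_inv]
    have h1 : ‖Complex.I ^ n + (-Complex.I) ^ n‖ ≤ 2 := by
      refine (norm_add_le _ _).trans ?_
      simp only [norm_pow, norm_neg, Complex.norm_I, one_pow]
      norm_num
    have h2 : (n : ℝ)⁻¹ ≤ (√(n : ℝ))⁻¹ := by
      apply inv_anti₀ (Real.sqrt_pos.2 (by linarith))
      exact Real.sqrt_le_iff.2 ⟨by linarith, by nlinarith⟩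
    gcongr
  | succ q ih =>
    obtain ⟨C, hC, h⟩ := ih
    refine ⟨4 * C, by positivity, fun n => ?_⟩
    rcases Nat.eq_zero_or_pos n with rfl | hn
    · simp [altCoeff]
    have hn' : (0 : ℝ) < n := by exact_mod_cast hn
    have h1 : ‖1 + (-1 : ℂ) ^ (q + 1) * (-1) ^ n‖ ≤ 2 := by
      refine (norm_add_le _ _).trans ?_
      simp only [norm_mul, norm_pow, norm_neg, norm_one, one_pow]
      norm_num
    have h2 : ‖∑ k ∈ Finset.range n, altCoeff q k‖ ≤ C * (2 * √(n : ℝ)) := by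
      refine (norm_sum_le_of_le _ fun k _ => h k).trans ?_
      rw [← Finset.mul_sum]
      gcongr
      exact sum_inv_sqrt_le n
    rw [altCoeff, norm_mul, norm_div, Complex.norm_natCast]
    calc _ ≤ 2 / n * (C * (2 * √(n : ℝ))) := by gcongr
      _ = 4 * C * (√(n : ℝ))⁻¹ := by
        nth_rewrite 1 [← Real.mul_self_sqrt hn'.le]
        have := Real.sqrt_pos.2 hn'
        field_simp
        ring

theorem tendsto_altCoeff (q : ℕ) : Tendsto (altCoeff q) atTop (𝓝 0) := by
  obtain ⟨C, _, h⟩ := exists_norm_altCoeff_le q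
  refine squeeze_zero_norm h ?_
  simpa using (tendsto_inv_atTop_zero.comp
    (Real.tendsto_sqrt_atTop.comp tendsto_natCast_atTop_atTop)).const_mul C

theorem exists_norm_altCoeff_le_const (q : ℕ) : ∃ C : ℝ, ∀ n : ℕ, ‖altCoeff q n‖ ≤ C := by
  obtain ⟨C, hC, h⟩ := exists_norm_altCoeff_le q
  refine ⟨C, fun n => (h n).trans (mul_le_of_le_one_right hC ?_)⟩
  rcases Nat.eq_zero_or_pos n with rfl | hn
  · simp
  · exact inv_le_one_of_one_le₀ (Real.one_le_sqrt.2 (by exact_mod_cast hn))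

theorem summable_norm_altCoeff_div (q : ℕ) : Summable fun n : ℕ => ‖altCoeff q n / n‖ := by
  obtain ⟨C, _, h⟩ := exists_norm_altCoeff_le q
  refine Summable.of_nonneg_of_le (fun _ => norm_nonneg _) (fun n => ?_)
    ((Real.summable_one_div_nat_rpow.2 (by norm_num : (1 : ℝ) < 3 / 2)).mul_left C)
  rw [norm_div, Complex.norm_natCast]
  rcases Nat.eq_zero_or_pos n with rfl | hn
  · simp
  have hn' : (0 : ℝ) < n := by exact_mod_cast hn
  calc ‖altCoeff q n‖ / n ≤ C * (√(n : ℝ))⁻¹ / n := by gcongr; exact h n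
    _ = C * (1 / (n : ℝ) ^ (3 / 2 : ℝ)) := by
      have h32 : (3 / 2 : ℝ) = 1 / 2 + 1 := by norm_num
      rw [h32, Real.rpow_add hn', Real.rpow_one, ← Real.sqrt_eq_rpow]
      field_simp

/-- The `S` and beta values are real limits while all computations are complex; uniqueness of limits
forces `l` to be real. -/
theorem tendsto_of_ofReal {u : ℕ → ℝ} {l : ℂ} (h : Tendsto (fun N => (u N : ℂ)) atTop (𝓝 l)) :
    Tendsto u atTop (𝓝 l.re) ∧ ((limUnder atTop u : ℝ) : ℂ) = l := by
  have h1 : Tendsto u atTop (𝓝 l.re) := by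
    exact (Complex.continuous_re.tendsto l).comp h
  refine ⟨h1, ?_⟩
  rw [h1.limUnder_eq]
  exact tendsto_nhds_unique ((Complex.continuous_ofReal.tendsto _).comp h1) h

theorem tendsto_multSPartial {m : ℕ} (hm : 1 ≤ m) :
    SeqConverges (multSPartial (signsBarBar m) (args21 m)) ∧
    ((multS (signsBarBar m) (args21 m) : ℝ) : ℂ) = (if Odd m then Complex.I else 1) *
      powSum (fun n => altCoeff m n / n) Complex.I := by
  have hs : Summable fun n : ℕ => altCoeff m n / n * Complex.I ^ n := by
    refine Summable.of_norm_bounded (summable_norm_altCoeff_div m) fun n => ?_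
    simp
  have h1 := (hs.seriesTendsto.comp_succ).const_mul (if Odd m then Complex.I else 1)
  have h2 := tendsto_of_ofReal (h1.congr fun N => (ofReal_multSPartial hm N).symm)
  exact ⟨⟨_, h2.1⟩, h2.2⟩

/-! ### Beta values and the distribution relation -/

theorem I_pow_even_odd (N : ℕ) :
    Complex.I ^ (2 * N) = (-1) ^ N ∧ (-Complex.I) ^ (2 * N) = (-1) ^ N ∧
    Complex.I ^ (2 * N + 1) = (-1) ^ N * Complex.I ∧
    (-Complex.I) ^ (2 * N + 1) = -((-1) ^ N * Complex.I) := by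
  have h1 : Complex.I ^ (2 * N) = (-1) ^ N := by rw [pow_mul, Complex.I_sq]
  have h2 : (-Complex.I) ^ (2 * N) = (-1) ^ N := by rw [pow_mul, neg_sq, Complex.I_sq]
  refine ⟨h1, h2, by rw [pow_succ, h1], by rw [pow_succ, h2]; ring⟩

/-- The combination `(i ^ n - (-i) ^ n) / (2i)` selects odd `n` with alternating sign, so `N` beta
terms use the indices below `2 * N`. -/
theorem ofReal_betaPartial (s N : ℕ) :
    ((betaPartial s N : ℝ) : ℂ) = (-Complex.I / 2) *
      (∑ n ∈ Finset.range (2 * N), polylogCoeff s Complex.I n -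
        ∑ n ∈ Finset.range (2 * N), polylogCoeff s (-Complex.I) n) := by
  induction N with
  | zero => simp [betaPartial]
  | succ N ih =>
    rw [betaPartial, Finset.sum_range_succ, ← betaPartial, Complex.ofReal_add, ih, mul_add, mul_one,
      Finset.sum_range_succ, Finset.sum_range_succ, Finset.sum_range_succ, Finset.sum_range_succ]
    obtain ⟨h1, h2, h3, h4⟩ := I_pow_even_odd N
    simp only [polylogCoeff, h1, h2, h3, h4]
    push_cast
    linear_combination ((-1) ^ N / (2 * (N : ℂ) + 1) ^ s) * Complex.I_sq

theorem tendsto_betaPartial {s : ℕ} (hs : 1 ≤ s) :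
    SeqConverges (betaPartial s) ∧ ((dirichletBeta s : ℝ) : ℂ) =
      (-Complex.I / 2) * (polylog ![s] ![Complex.I] - polylog ![s] ![-Complex.I]) := by
  have hI : Complex.I ≠ 1 := fun h => by simpa using congrArg Complex.im h
  have hI' : -Complex.I ≠ 1 := fun h => by simpa using congrArg Complex.im h
  have h1 := seriesTendsto_polylog (p := s) (x := Complex.I) (by simp) (Or.inr ⟨hs, hI⟩)
  have h2 := seriesTendsto_polylog (p := s) (x := -Complex.I) (by simp) (Or.inr ⟨hs, hI'⟩)
  have h3 : Tendsto (fun N : ℕ => 2 * N) atTop atTop :=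
    tendsto_id.const_mul_atTop' two_pos
  have h4 := ((h1.sub h2).comp h3).const_mul (-Complex.I / 2)
  have h5 := tendsto_of_ofReal (h4.congr fun N => (ofReal_betaPartial s N).symm)
  exact ⟨⟨_, h5.1⟩, h5.2⟩

/-- The distribution relation `Li_p(i) + Li_p(-i) = 2 ^ (1 - p) Li_p(-1)`. -/
theorem polylog_I_add_polylog_neg_I {p : ℕ} (hp : 1 ≤ p) :
    polylog ![p] ![Complex.I] + polylog ![p] ![-Complex.I] = 2 / 2 ^ p * polylog ![p] ![-1] := by
  have hI : Complex.I ≠ 1 := fun h => by simpa using congrArg Complex.im h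
  have hI' : -Complex.I ≠ 1 := fun h => by simpa using congrArg Complex.im h
  have h1 := seriesTendsto_polylog (p := p) (x := Complex.I) (by simp) (Or.inr ⟨hp, hI⟩)
  have h2 := seriesTendsto_polylog (p := p) (x := -Complex.I) (by simp) (Or.inr ⟨hp, hI'⟩)
  have h0 := seriesTendsto_polylog (p := p) (x := -1) (by simp) (Or.inr ⟨hp, by norm_num⟩)
  have h3 : Tendsto (fun N : ℕ => 2 * N) atTop atTop :=
    tendsto_id.const_mul_atTop' two_pos
  -- Only even indices survive on the left, so its truncation at `2 * N` matches the one at `N` on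
  -- the right term by term.
  refine tendsto_nhds_unique ((h1.add h2).comp h3) ((h0.const_mul _).congr fun N => ?_)
  simp only [Function.comp]
  induction N with
  | zero => simp
  | succ N ih =>
    rw [Finset.sum_range_succ, mul_add, ih, mul_add, mul_one,
      Finset.sum_range_succ, Finset.sum_range_succ, Finset.sum_range_succ, Finset.sum_range_succ]
    obtain ⟨h1, h2, h3, h4⟩ := I_pow_even_odd N
    simp only [polylogCoeff, h1, h2, h3, h4]
    push_cast
    rw [mul_pow]
    ring

/-! ### Differential equations of the generating series -/

theorem one_sub_mul_ne_zero {x s : ℂ} (hx : ‖x‖ ≤ 1) (hs : ‖s‖ < 1) : 1 - x * s ≠ 0 := by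
  intro h
  have h1 : ‖x * s‖ = 1 := by rw [← sub_eq_zero.1 h, norm_one]
  rw [norm_mul] at h1
  nlinarith [norm_nonneg x, norm_nonneg s]

theorem hasDerivAt_polylog_one {x s : ℂ} (hx : ‖x‖ ≤ 1) (hs : ‖s‖ < 1) (hs0 : s ≠ 0) :
    HasDerivAt (powSum (polylogCoeff 1 x)) (x / (1 - x * s)) s := by
  have hxs : ‖x * s‖ < 1 := by
    rw [norm_mul]; nlinarith [norm_nonneg x, norm_nonneg s]
  have hne := one_sub_mul_ne_zero hx hs
  convert hasDerivAt_powSum_euler (a := fun n => x ^ n - if n = 0 then 1 else 0)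
    (norm_polylogCoeff_le_one 1 hx) (fun n => ?_) hs hs0 using 1
  · have h1 : powSum (fun n => x ^ n - if n = 0 then 1 else 0) s = (1 - x * s)⁻¹ - 1 := by
      rw [powSum, ← tsum_geometric_of_norm_lt_one hxs, ← tsum_ite_eq 0 (fun _ => (1 : ℂ)),
        ← (summable_geometric_of_norm_lt_one hxs).tsum_sub (hasSum_ite_eq 0 (1 : ℂ)).summable]
      refine tsum_congr fun n => ?_
      rcases n with _ | n
      · simp
      · simp [mul_pow]
    rw [h1]
    field_simp
    ring
  · rcases n with _ | n
    · simp [polylogCoeff]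
    · have : ((n + 1 : ℕ) : ℂ) ≠ 0 := Nat.cast_ne_zero.2 (Nat.succ_ne_zero n)
      simp only [polylogCoeff, Nat.succ_ne_zero, if_false, pow_one]
      field_simp
      ring

theorem hasDerivAt_polylog_succ {p : ℕ} (hp : 1 ≤ p) {x s : ℂ} (hx : ‖x‖ ≤ 1) (hs : ‖s‖ < 1)
    (hs0 : s ≠ 0) :
    HasDerivAt (powSum (polylogCoeff (p + 1) x)) (powSum (polylogCoeff p x) s / s) s := by
  refine hasDerivAt_powSum_euler (norm_polylogCoeff_le_one _ hx) (fun n => ?_) hs hs0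
  rcases n with _ | n
  · simp [polylogCoeff_zero hp]
  · have : ((n + 1 : ℕ) : ℂ) ≠ 0 := Nat.cast_ne_zero.2 (Nat.succ_ne_zero n)
    rw [polylogCoeff, polylogCoeff, pow_succ ((n + 1 : ℕ) : ℂ)]
    field_simp

/-- The operator `s d/ds` cancels the outer `1 / n`, leaving partial sums times `x ^ n`, which
`powSum_cumulative` sums at `x * s`; hence the product `x * y` in the inner polylogarithm. -/
theorem hasDerivAt_double {q : ℕ} {x y s : ℂ} (hx : ‖x‖ ≤ 1) (hy : ‖y‖ ≤ 1) (hs : ‖s‖ < 1)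
    (hs0 : s ≠ 0) :
    HasDerivAt (powSum (doubleCoeff 1 q x y))
      (x / (1 - x * s) * powSum (polylogCoeff q (x * y)) s) s := by
  have hxs : ‖x * s‖ < 1 := by
    rw [norm_mul]; nlinarith [norm_nonneg x, norm_nonneg s]
  convert hasDerivAt_powSum_euler
    (a := fun n => (∑ k ∈ Finset.range n, polylogCoeff q y k) * x ^ n)
    (norm_doubleCoeff_one_le (q := q) hx hy) (fun n => ?_) hs hs0 using 1
  · rw [powSum_mul_pow, powSum_cumulative (norm_polylogCoeff_le_one q hy) hxs, ← powSum_mul_pow]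
    have : (fun n => polylogCoeff q y n * x ^ n) = polylogCoeff q (x * y) := by
      funext n
      rw [polylogCoeff, polylogCoeff, mul_pow]; ring
    rw [this]
    field_simp
  · rcases n with _ | n
    · simp
    · have : ((n + 1 : ℕ) : ℂ) ≠ 0 := Nat.cast_ne_zero.2 (Nat.succ_ne_zero n)
      rw [doubleCoeff, polylogCoeff, pow_one]
      field_simp

theorem powSum_altCoeff_zero {t : ℂ} (ht : ‖t‖ < 1) : powSum (altCoeff 0) t =
    powSum (polylogCoeff 1 Complex.I) t + powSum (polylogCoeff 1 (-Complex.I)) t := by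
  rw [powSum, powSum, powSum, ← Summable.tsum_add
    (summable_of_norm_le (norm_polylogCoeff_le_one 1 (by simp)) ht)
    (summable_of_norm_le (norm_polylogCoeff_le_one 1 (by simp)) ht)]
  refine tsum_congr fun n => ?_
  rw [altCoeff, polylogCoeff, polylogCoeff]
  ring

theorem hasDerivAt_powSum_altCoeff_zero {t : ℂ} (ht : ‖t‖ < 1) (ht0 : t ≠ 0) :
    HasDerivAt (powSum (altCoeff 0))
      (Complex.I / (1 - Complex.I * t) + -Complex.I / (1 - -Complex.I * t)) t := by
  refine ((hasDerivAt_polylog_one (by simp) ht ht0).add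
    (hasDerivAt_polylog_one (by simp) ht ht0)).congr_of_eventuallyEq ?_
  filter_upwards [Metric.isOpen_ball.mem_nhds (mem_ball_zero_iff.2 ht)] with z hz
  exact powSum_altCoeff_zero (mem_ball_zero_iff.1 hz)

theorem powSum_altCoeff_neg (q : ℕ) (t : ℂ) :
    powSum (altCoeff q) (-t) = (-1) ^ q * powSum (altCoeff q) t := by
  rw [powSum, powSum, ← tsum_mul_left]
  refine tsum_congr fun n => ?_
  rw [neg_pow, ← mul_assoc, altCoeff_mul_neg_one_pow, mul_assoc]

/-- The parity factor combines the cumulative series at `t` and `-t`. As `F_q` has parity `q`, they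
add up to `t/(1-t) + t/(1+t) = 2t/(1-t²)` times `F_q(t)`. -/
theorem hasDerivAt_powSum_altCoeff_succ (q : ℕ) {t : ℂ} (ht : ‖t‖ < 1) (ht0 : t ≠ 0) :
    HasDerivAt (powSum (altCoeff (q + 1))) (2 / (1 - t ^ 2) * powSum (altCoeff q) t) t := by
  obtain ⟨C, hC⟩ := exists_norm_altCoeff_le_const q
  obtain ⟨C', hC'⟩ := exists_norm_altCoeff_le_const (q + 1)
  have hC0 : 0 ≤ C := (norm_nonneg _).trans (hC 0)
  have hA : ∀ n : ℕ, ‖∑ k ∈ Finset.range n, altCoeff q k‖ ≤ C * (n + 1) := fun n => by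
    refine (norm_sum_le_of_le _ fun k _ => hC k).trans ?_
    rw [Finset.sum_const, Finset.card_range, nsmul_eq_mul]
    linarith
  have ht' : ‖-t‖ < 1 := by rwa [norm_neg]
  have h1 : 1 - t ≠ 0 := by simpa using one_sub_mul_ne_zero (x := 1) (by simp) ht
  have h2 : 1 + t ≠ 0 := by simpa using one_sub_mul_ne_zero (x := -1) (by simp) ht
  have h3 : 1 - t ^ 2 ≠ 0 := by
    rw [show 1 - t ^ 2 = (1 - t) * (1 + t) by ring]; exact mul_ne_zero h1 h2
  have h4 : ((-1 : ℂ) ^ q) * (-1) ^ q = 1 := by rw [← mul_pow]; simp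
  set A : ℕ → ℂ := fun n => ∑ k ∈ Finset.range n, altCoeff q k with hAdef
  convert hasDerivAt_powSum_euler (a := fun n => (1 + (-1) ^ (q + 1) * (-1) ^ n) * A n)
    hC' (fun n => ?_) ht ht0 using 1
  · have h5 : powSum (fun n => (1 + (-1) ^ (q + 1) * (-1) ^ n) * A n) t =
        powSum A t + (-1) ^ (q + 1) * powSum A (-t) := by
      rw [powSum, powSum, powSum, ← tsum_mul_left, ← Summable.tsum_add
        (summable_of_norm_le_linear hA ht)
        ((summable_of_norm_le_linear hA ht').mul_left _)]
      refine tsum_congr fun n => ?_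
      rw [neg_pow t]
      ring
    rw [h5, hAdef, powSum_cumulative hC ht, powSum_cumulative hC ht', powSum_altCoeff_neg,
      sub_neg_eq_add, pow_succ]
    field_simp
    linear_combination (-1 + t ^ 2) * powSum (altCoeff q) t * (1 - t) * h4
  · rcases n with _ | n
    · simp [hAdef]
    · have : ((n + 1 : ℕ) : ℂ) ≠ 0 := Nat.cast_ne_zero.2 (Nat.succ_ne_zero n)
      rw [altCoeff]
      simp only [hAdef]
      field_simp

theorem norm_altCoeff_div_le {q : ℕ} {C : ℝ} (hC : ∀ n, ‖altCoeff q n‖ ≤ C) (n : ℕ) :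
    ‖altCoeff q n / n‖ ≤ C := by
  rcases Nat.eq_zero_or_pos n with rfl | hn
  · simpa using (norm_nonneg _).trans (hC 0)
  · rw [norm_div, Complex.norm_natCast]
    exact (div_le_self (norm_nonneg _) (by exact_mod_cast hn)).trans (hC n)

theorem hasDerivAt_powSum_altCoeff_div (q : ℕ) {t : ℂ} (ht : ‖t‖ < 1) (ht0 : t ≠ 0) :
    HasDerivAt (powSum fun n => altCoeff q n / n) (powSum (altCoeff q) t / t) t := by
  obtain ⟨C, hC⟩ := exists_norm_altCoeff_le_const q
  refine hasDerivAt_powSum_euler (norm_altCoeff_div_le hC) (fun n => ?_) ht ht0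
  rcases n with _ | n
  · simp [altCoeff_zero_right]
  · have : ((n + 1 : ℕ) : ℂ) ≠ 0 := Nat.cast_ne_zero.2 (Nat.succ_ne_zero n)
    field_simp

/-! ### The substitution `t = (1 - s) / (1 + s)` -/

/-- The right half of the open unit disc. -/
def halfDisc : Set ℂ := {s | 0 < s.re ∧ ‖s‖ < 1}

theorem isOpen_halfDisc : IsOpen halfDisc :=
  (isOpen_lt continuous_const Complex.continuous_re).inter
    (isOpen_lt continuous_norm continuous_const)

theorem convex_halfDisc : Convex ℝ halfDisc := by
  have h := (convex_halfSpace_re_gt 0).inter (convex_ball (0 : ℂ) 1)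
  convert h using 1
  ext s
  simp [halfDisc]

theorem ne_zero_of_mem_halfDisc {s : ℂ} (hs : s ∈ halfDisc) : s ≠ 0 := by
  rintro rfl
  simpa using hs.1

/-- The involution `s ↦ (1 - s) / (1 + s)`. -/
noncomputable def cayley (s : ℂ) : ℂ := (1 - s) / (1 + s)

theorem one_add_ne_zero_of_re {s : ℂ} (hs : 0 < s.re) : 1 + s ≠ 0 := fun h => by
  have := congrArg Complex.re h
  simp at this
  linarith

theorem norm_cayley_sq {s : ℂ} (hs : 0 < s.re) :
    ‖cayley s‖ ^ 2 = 1 - 4 * s.re / ‖1 + s‖ ^ 2 := by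
  have h : 0 < ‖1 + s‖ ^ 2 := pow_pos (norm_pos_iff.2 (one_add_ne_zero_of_re hs)) 2
  have h1 : ‖1 - s‖ ^ 2 = ‖1 + s‖ ^ 2 - 4 * s.re := by
    rw [Complex.sq_norm, Complex.sq_norm, Complex.normSq_apply, Complex.normSq_apply]
    simp only [Complex.sub_re, Complex.sub_im, Complex.add_re, Complex.add_im, Complex.one_re,
      Complex.one_im]
    ring
  rw [cayley, norm_div, div_pow, h1, sub_div, div_self h.ne']

/-- From `‖1 + s‖ ≤ 2` one gets `1 - ‖cayley s‖² ≥ Re s`. Near `-i` this keeps `t` at distance of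
order `ε` from the unit circle. -/
theorem norm_cayley_le {s : ℂ} (hs : 0 < s.re) (hs1 : ‖s‖ ≤ 1) :
    ‖cayley s‖ ≤ 1 - s.re / 2 := by
  have h : 0 < ‖1 + s‖ ^ 2 := pow_pos (norm_pos_iff.2 (one_add_ne_zero_of_re hs)) 2
  have h1 : ‖1 + s‖ ≤ 2 := by
    refine (norm_add_le _ _).trans ?_
    rw [norm_one]; linarith
  have h4 : ‖1 + s‖ ^ 2 ≤ 4 := by nlinarith [norm_nonneg (1 + s)]
  have h2 : s.re ≤ 4 * s.re / ‖1 + s‖ ^ 2 := by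
    rw [le_div_iff₀ h]
    nlinarith
  have h3 : s.re ≤ 1 := (Complex.re_le_norm s).trans hs1
  refine (abs_le_of_sq_le_sq' ?_ (by linarith)).2
  rw [norm_cayley_sq hs]
  nlinarith [sq_nonneg s.re]

theorem norm_cayley_lt_one {s : ℂ} (hs : s ∈ halfDisc) : ‖cayley s‖ < 1 := by
  have := norm_cayley_le hs.1 hs.2.le
  linarith [hs.1]

theorem one_sub_ne_zero_of_norm {s : ℂ} (hs : ‖s‖ < 1) : 1 - s ≠ 0 := by
  simpa using one_sub_mul_ne_zero (x := 1) (by simp) hs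

theorem cayley_ne_zero {s : ℂ} (hs : s ∈ halfDisc) : cayley s ≠ 0 :=
  div_ne_zero (one_sub_ne_zero_of_norm hs.2) (one_add_ne_zero_of_re hs.1)

theorem hasDerivAt_cayley {s : ℂ} (hs : 1 + s ≠ 0) : HasDerivAt cayley (-2 / (1 + s) ^ 2) s := by
  refine HasDerivAt.congr_deriv (((hasDerivAt_id s).const_sub 1).div ((hasDerivAt_id s).const_add 1) hs) (Eq.symm ?_)
  simp only [id]
  field_simp
  ring

theorem one_add_sq_ne_zero {s : ℂ} (hs : ‖s‖ < 1) : 1 + s ^ 2 ≠ 0 := by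
  have h1 : ‖s ^ 2‖ < 1 := by
    rw [norm_pow]; exact pow_lt_one₀ (norm_nonneg _) hs two_ne_zero
  simpa using one_sub_mul_ne_zero (x := -1) (by simp) h1

theorem one_sub_sq_ne_zero {s : ℂ} (hs : ‖s‖ < 1) : 1 - s ^ 2 ≠ 0 := by
  have h1 : ‖s ^ 2‖ < 1 := by
    rw [norm_pow]; exact pow_lt_one₀ (norm_nonneg _) hs two_ne_zero
  exact one_sub_ne_zero_of_norm h1

/-- The differential form attached to the innermost summation variable. -/
noncomputable def alternatingKernel (s : ℂ) : ℂ := 1 / (1 + s) - s / (1 + s ^ 2)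

/-- Since `1 + t² = 2(1+s²)/(1+s)²`, the form `-2t dt/(1+t²)` becomes `2(1-s) ds/((1+s)(1+s²))`, and
partial fractions give the kernel. -/
theorem hasDerivAt_altCoeff_zero_cayley {s : ℂ} (hs : s ∈ halfDisc) :
    HasDerivAt (fun s => powSum (altCoeff 0) (cayley s)) (2 * alternatingKernel s) s := by
  have h1 := one_add_ne_zero_of_re hs.1
  have h2 := one_add_sq_ne_zero hs.2
  have ht := norm_cayley_lt_one hs
  have h3 : 1 - Complex.I * cayley s ≠ 0 := one_sub_mul_ne_zero (by simp) ht
  have h4 : 1 - -Complex.I * cayley s ≠ 0 := one_sub_mul_ne_zero (by simp) ht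
  refine HasDerivAt.congr_deriv ((hasDerivAt_powSum_altCoeff_zero ht (cayley_ne_zero hs)).comp s
    (hasDerivAt_cayley h1)) (Eq.symm ?_)
  have h5 : Complex.I / (1 - Complex.I * cayley s) + -Complex.I / (1 - -Complex.I * cayley s) =
      -2 * cayley s / (1 + cayley s ^ 2) := by
    have h6 : (1 - Complex.I * cayley s) * (1 - -Complex.I * cayley s) = 1 + cayley s ^ 2 := by
      linear_combination -(cayley s ^ 2) * Complex.I_sq
    rw [← h6, div_add_div _ _ h3 h4]
    congr 1
    linear_combination 2 * cayley s * Complex.I_sq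
  have h7 : (1 + s) ^ 2 + (1 - s) ^ 2 ≠ 0 := by
    rw [show (1 + s) ^ 2 + (1 - s) ^ 2 = 2 * (1 + s ^ 2) by ring]
    exact mul_ne_zero two_ne_zero h2
  have h8 : 1 + cayley s ^ 2 = 2 * (1 + s ^ 2) / (1 + s) ^ 2 := by
    rw [cayley]; field_simp; ring
  rw [h5, h8, cayley, alternatingKernel]
  field_simp
  ring

/-- Here `1 - t² = 4s/(1+s)²`, so `2 dt/(1-t²)` becomes `-ds/s`. -/
theorem hasDerivAt_altCoeff_succ_cayley (q : ℕ) {s : ℂ} (hs : s ∈ halfDisc) :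
    HasDerivAt (fun s => powSum (altCoeff (q + 1)) (cayley s))
      (-(1 / s * powSum (altCoeff q) (cayley s))) s := by
  have h1 := one_add_ne_zero_of_re hs.1
  have h0 := ne_zero_of_mem_halfDisc hs
  refine HasDerivAt.congr_deriv ((hasDerivAt_powSum_altCoeff_succ q (norm_cayley_lt_one hs) (cayley_ne_zero hs)).comp s
    (hasDerivAt_cayley h1)) (Eq.symm ?_)
  have h8 : 1 - cayley s ^ 2 = 4 * s / (1 + s) ^ 2 := by
    rw [cayley]; field_simp; ring
  rw [h8]
  field_simp
  ring

theorem hasDerivAt_altCoeff_div_cayley (q : ℕ) {s : ℂ} (hs : s ∈ halfDisc) :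
    HasDerivAt (fun s => powSum (fun n => altCoeff q n / n) (cayley s))
      (-(2 / (1 - s ^ 2)) * powSum (altCoeff q) (cayley s)) s := by
  have h1 := one_add_ne_zero_of_re hs.1
  have h2 := one_sub_ne_zero_of_norm hs.2
  have h3 := one_sub_sq_ne_zero hs.2
  refine HasDerivAt.congr_deriv ((hasDerivAt_powSum_altCoeff_div q (norm_cayley_lt_one hs) (cayley_ne_zero hs)).comp s
    (hasDerivAt_cayley h1)) (Eq.symm ?_)
  rw [show 1 - s ^ 2 = (1 - s) * (1 + s) by ring]
  rw [show powSum (altCoeff q) (cayley s) / cayley s =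
    powSum (altCoeff q) (cayley s) * (1 + s) / (1 - s) by nth_rewrite 2 [cayley]; field_simp]
  field_simp

/-! ### Explicit primitives and integration by parts -/

/-- Telescoping of the derivative of a convolution of iterated primitives. -/
theorem hasDerivAt_sum_antidiagonal {u v : ℕ → ℂ → ℂ} {α β w s : ℂ}
    (hu0 : HasDerivAt (u 0) α s) (hu : ∀ i, HasDerivAt (u (i + 1)) (-(w * u i s)) s)
    (hv0 : HasDerivAt (v 0) β s) (hv : ∀ j, HasDerivAt (v (j + 1)) (w * v j s) s) (m : ℕ) :
    HasDerivAt (fun z => ∑ x ∈ Finset.HasAntidiagonal.antidiagonal m, u x.1 z * v x.2 z)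
      (α * v m s + u m s * β) s := by
  let u' : ℕ → ℂ := fun i => Nat.casesOn i α fun i => -(w * u i s)
  let v' : ℕ → ℂ := fun i => Nat.casesOn i β fun i => w * v i s
  have hu' : ∀ i, HasDerivAt (u i) (u' i) s := fun i => by
    cases i with
    | zero => exact hu0
    | succ i => exact hu i
  have hv' : ∀ i, HasDerivAt (v i) (v' i) s := fun i => by
    cases i with
    | zero => exact hv0
    | succ i => exact hv i
  refine HasDerivAt.congr_deriv (HasDerivAt.fun_sum (u := Finset.HasAntidiagonal.antidiagonal m)
    (fun x _ => (hu' x.1).mul (hv' x.2))) (Eq.symm ?_)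
  rw [Finset.sum_add_distrib]
  cases m with
  | zero => simp [u', v']
  | succ m =>
    -- The two sums lose opposite end terms; the remaining terms cancel in pairs because the
    -- recursions of `u` and `v` carry opposite signs.
    rw [Finset.Nat.sum_antidiagonal_succ, Finset.Nat.sum_antidiagonal_succ']
    have : ∑ x ∈ Finset.HasAntidiagonal.antidiagonal m, u' (x.1 + 1) * v x.2 s =
        -∑ x ∈ Finset.HasAntidiagonal.antidiagonal m, u x.1 s * v' (x.2 + 1) := by
      rw [← Finset.sum_neg_distrib]
      refine Finset.sum_congr rfl fun x _ => ?_
      simp only [u', v']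
      ring
    rw [this, show u' 0 = α from rfl, show v' 0 = β from rfl]
    ring

/-- `(log s + iπ/2) ^ l / l!`. -/
noncomputable def logPow (l : ℕ) (s : ℂ) : ℂ :=
  (Complex.log s + Complex.I * (Real.pi : ℂ) / 2) ^ l / (l.factorial : ℂ)

theorem hasDerivAt_logPow_zero (s : ℂ) : HasDerivAt (logPow 0) 0 s := by
  have : logPow 0 = fun _ => 1 := by funext; simp [logPow]
  rw [this]
  exact hasDerivAt_const s 1

theorem hasDerivAt_logPow_succ (l : ℕ) {s : ℂ} (hs : 0 < s.re) :
    HasDerivAt (logPow (l + 1)) (1 / s * logPow l s) s := by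
  have h0 : s ∈ Complex.slitPlane := Or.inl hs
  have h1 : (l.factorial : ℂ) ≠ 0 := Nat.cast_ne_zero.2 (Nat.factorial_ne_zero l)
  have h2 : ((l : ℂ) + 1) ≠ 0 := Nat.cast_add_one_ne_zero l
  have h3 : s ≠ 0 := Complex.slitPlane_ne_zero h0
  refine HasDerivAt.congr_deriv (((((Complex.hasDerivAt_log h0).add_const
    (Complex.I * (Real.pi : ℂ) / 2)).pow (l + 1)).div_const ((l + 1).factorial : ℂ))) (Eq.symm ?_)
  rw [logPow, Nat.factorial_succ]
  push_cast
  field_simp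

/-- The odd part `∑_{n odd} s ^ n / n ^ p` of the polylogarithm. -/
noncomputable def legendreChi (p : ℕ) (s : ℂ) : ℂ :=
  (powSum (polylogCoeff p 1) s - powSum (polylogCoeff p (-1)) s) / 2

theorem hasDerivAt_legendreChi_one {s : ℂ} (hs : ‖s‖ < 1) (hs0 : s ≠ 0) :
    HasDerivAt (legendreChi 1) (1 / (1 - s ^ 2)) s := by
  refine HasDerivAt.congr_deriv (((hasDerivAt_polylog_one (x := 1) (by simp) hs hs0).sub
    (hasDerivAt_polylog_one (x := -1) (by simp) hs hs0)).div_const 2) (Eq.symm ?_)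
  have h1 := one_sub_ne_zero_of_norm hs
  have h2 : 1 + s ≠ 0 := by simpa using one_sub_mul_ne_zero (x := -1) (by simp) hs
  rw [show 1 - s ^ 2 = (1 - s) * (1 + s) by ring, one_mul, neg_one_mul, sub_neg_eq_add]
  field_simp
  ring

theorem hasDerivAt_legendreChi_succ {p : ℕ} (hp : 1 ≤ p) {s : ℂ} (hs : ‖s‖ < 1) (hs0 : s ≠ 0) :
    HasDerivAt (legendreChi (p + 1)) (1 / s * legendreChi p s) s := by
  refine HasDerivAt.congr_deriv (((hasDerivAt_polylog_succ hp (x := 1) (by simp) hs hs0).sub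
    (hasDerivAt_polylog_succ hp (x := -1) (by simp) hs hs0)).div_const 2) (Eq.symm ?_)
  rw [legendreChi]
  ring

/-- Iterated primitives of `1 / (1 - s²)`, with integration constants `X`. -/
noncomputable def iteratedChi (X : ℕ → ℂ) (j : ℕ) (s : ℂ) : ℂ :=
  legendreChi (j + 1) s - ∑ x ∈ Finset.HasAntidiagonal.antidiagonal j, X x.2 * logPow x.1 s

theorem hasDerivAt_iteratedChi_zero (X : ℕ → ℂ) {s : ℂ} (hs : s ∈ halfDisc) :
    HasDerivAt (iteratedChi X 0) (1 / (1 - s ^ 2)) s := by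
  have : iteratedChi X 0 = fun s => legendreChi 1 s - X 0 := by
    funext s; simp [iteratedChi, logPow]
  rw [this]
  exact (hasDerivAt_legendreChi_one hs.2 (ne_zero_of_mem_halfDisc hs)).sub_const _

theorem hasDerivAt_iteratedChi_succ (X : ℕ → ℂ) (j : ℕ) {s : ℂ} (hs : s ∈ halfDisc) :
    HasDerivAt (iteratedChi X (j + 1)) (1 / s * iteratedChi X j s) s := by
  have : iteratedChi X (j + 1) = fun s => legendreChi (j + 1 + 1) s - (X (j + 1) +
      ∑ x ∈ Finset.HasAntidiagonal.antidiagonal j, X x.2 * logPow (x.1 + 1) s) := by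
    funext s
    rw [iteratedChi, Finset.Nat.sum_antidiagonal_succ]
    simp [logPow]
  rw [this]
  refine HasDerivAt.congr_deriv ((hasDerivAt_legendreChi_succ (Nat.succ_pos j) hs.2 (ne_zero_of_mem_halfDisc hs)).sub
    ((HasDerivAt.fun_sum (u := Finset.HasAntidiagonal.antidiagonal j) fun x _ =>
      (hasDerivAt_logPow_succ x.1 hs.1).const_mul (X x.2)).const_add (X (j + 1)))) (Eq.symm ?_)
  rw [iteratedChi, mul_sub, Finset.mul_sum]
  congr 1
  refine Finset.sum_congr rfl fun x _ => ?_
  ring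

/-- Iterated primitives of `alternatingKernel` for the form `ds / s`. -/
noncomputable def kernelPolylog (p : ℕ) (s : ℂ) : ℂ :=
  -powSum (polylogCoeff p (-1)) s +
    (powSum (polylogCoeff p Complex.I) s + powSum (polylogCoeff p (-Complex.I)) s) / 2

/-- Partial fractions over `±i`: `-s/(1+s²)` is half of `i/(1-is) - i/(1+is)`. -/
theorem hasDerivAt_kernelPolylog_one {s : ℂ} (hs : ‖s‖ < 1) (hs0 : s ≠ 0) :
    HasDerivAt (kernelPolylog 1) (alternatingKernel s) s := by
  refine HasDerivAt.congr_deriv ((hasDerivAt_polylog_one (x := -1) (by simp) hs hs0).neg.add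
    (((hasDerivAt_polylog_one (x := Complex.I) (by simp) hs hs0).add
    (hasDerivAt_polylog_one (x := -Complex.I) (by simp) hs hs0)).div_const 2)) (Eq.symm ?_)
  have h1 := one_sub_mul_ne_zero (x := -1) (by simp) hs
  have h2 : 1 - Complex.I * s ≠ 0 := one_sub_mul_ne_zero (by simp) hs
  have h3 : 1 - -Complex.I * s ≠ 0 := one_sub_mul_ne_zero (by simp) hs
  have h4 : 1 + s ^ 2 = (1 - Complex.I * s) * (1 - -Complex.I * s) := by
    linear_combination s ^ 2 * Complex.I_sq
  rw [alternatingKernel, h4, show 1 + s = 1 - -1 * s by ring]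
  have h5 : Complex.I / (1 - Complex.I * s) + -Complex.I / (1 - -Complex.I * s) =
      -2 * s / ((1 - Complex.I * s) * (1 - -Complex.I * s)) := by
    rw [div_add_div _ _ h2 h3]
    congr 1
    linear_combination 2 * s * Complex.I_sq
  rw [h5]
  ring

theorem hasDerivAt_kernelPolylog_succ {p : ℕ} (hp : 1 ≤ p) {s : ℂ} (hs : ‖s‖ < 1) (hs0 : s ≠ 0) :
    HasDerivAt (kernelPolylog (p + 1)) (1 / s * kernelPolylog p s) s := by
  refine HasDerivAt.congr_deriv ((hasDerivAt_polylog_succ hp (x := -1) (by simp) hs hs0).neg.add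
    (((hasDerivAt_polylog_succ hp (x := Complex.I) (by simp) hs hs0).add
    (hasDerivAt_polylog_succ hp (x := -Complex.I) (by simp) hs hs0)).div_const 2)) (Eq.symm ?_)
  rw [kernelPolylog]
  ring

/-- A primitive of `alternatingKernel s * logPow l s`. -/
noncomputable def kernelLog (l : ℕ) (s : ℂ) : ℂ :=
  ∑ x ∈ Finset.HasAntidiagonal.antidiagonal l, ((-1) ^ x.1 * kernelPolylog (x.1 + 1) s) * logPow x.2 s

/-- The convolution telescopes, and because `logPow 0` is constant only the kernel term survives. -/
theorem hasDerivAt_kernelLog (l : ℕ) {s : ℂ} (hs : s ∈ halfDisc) :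
    HasDerivAt (kernelLog l) (alternatingKernel s * logPow l s) s := by
  have h0 := ne_zero_of_mem_halfDisc hs
  have h := hasDerivAt_sum_antidiagonal (u := fun p z => (-1) ^ p * kernelPolylog (p + 1) z)
    (v := logPow) (α := alternatingKernel s) (β := 0) (w := 1 / s) (s := s)
    (by simpa using hasDerivAt_kernelPolylog_one hs.2 h0)
    (fun i => by
      refine HasDerivAt.congr_deriv ((hasDerivAt_kernelPolylog_succ (Nat.succ_pos i) hs.2 h0).const_mul
        ((-1) ^ (i + 1))) (Eq.symm ?_)
      rw [pow_succ]
      ring)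
    (hasDerivAt_logPow_zero s) (fun j => hasDerivAt_logPow_succ j hs.1) l
  rw [mul_zero, add_zero] at h
  exact h

/-- A primitive of `alternatingKernel s * legendreChi q s`. -/
noncomputable def kernelChi (q : ℕ) (s : ℂ) : ℂ :=
  (-powSum (doubleCoeff 1 q (-1) (-1)) s + powSum (doubleCoeff 1 q (-1) 1) s) / 2 +
  (powSum (doubleCoeff 1 q Complex.I (-Complex.I)) s -
    powSum (doubleCoeff 1 q Complex.I Complex.I) s +
    powSum (doubleCoeff 1 q (-Complex.I) Complex.I) s -
    powSum (doubleCoeff 1 q (-Complex.I) (-Complex.I)) s) / 4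

/-- Each pole `x` of the kernel is paired with the two `y` for which `x * y = ±1`, so the inner
polylogarithms combine to the odd part. -/
theorem hasDerivAt_kernelChi (q : ℕ) {s : ℂ} (hs : ‖s‖ < 1) (hs0 : s ≠ 0) :
    HasDerivAt (kernelChi q) (alternatingKernel s * legendreChi q s) s := by
  have hd : ∀ x y : ℂ, ‖x‖ ≤ 1 → ‖y‖ ≤ 1 → HasDerivAt (powSum (doubleCoeff 1 q x y))
      (x / (1 - x * s) * powSum (polylogCoeff q (x * y)) s) s :=
    fun x y hx hy => hasDerivAt_double hx hy hs hs0
  have n1 : ‖(-1 : ℂ)‖ ≤ 1 := by simp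
  have n2 : ‖(1 : ℂ)‖ ≤ 1 := by simp
  have n3 : ‖Complex.I‖ ≤ 1 := by simp
  have n4 : ‖-Complex.I‖ ≤ 1 := by simp
  have h1 := one_sub_mul_ne_zero n1 hs
  have h2 := one_sub_mul_ne_zero n3 hs
  have h3 := one_sub_mul_ne_zero n4 hs
  refine HasDerivAt.congr_deriv ((((hd _ _ n1 n1).neg.add (hd _ _ n1 n2)).div_const 2).add
    (((((hd _ _ n3 n4).sub (hd _ _ n3 n3)).add (hd _ _ n4 n3)).sub (hd _ _ n4 n4)).div_const 4)) (Eq.symm ?_)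
  have h4 : 1 + s ^ 2 = (1 - Complex.I * s) * (1 - -Complex.I * s) := by
    linear_combination s ^ 2 * Complex.I_sq
  have h5 : Complex.I / (1 - Complex.I * s) + -Complex.I / (1 - -Complex.I * s) =
      -2 * s / ((1 - Complex.I * s) * (1 - -Complex.I * s)) := by
    rw [div_add_div _ _ h2 h3]
    congr 1
    linear_combination 2 * s * Complex.I_sq
  have e1 : Complex.I * -Complex.I = 1 := by simp
  have e2 : Complex.I * Complex.I = -1 := by simp
  have e3 : -Complex.I * Complex.I = 1 := by simp
  have e4 : -Complex.I * -Complex.I = -1 := by simp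
  have e5 : (-1 : ℂ) * -1 = 1 := by norm_num
  have e6 : (-1 : ℂ) * 1 = -1 := by norm_num
  rw [e1, e2, e3, e4, e5, e6, alternatingKernel, legendreChi, h4, show 1 + s = 1 - -1 * s by ring]
  linear_combination (-(powSum (polylogCoeff q 1) s - powSum (polylogCoeff q (-1)) s) / 4) * h5

/-- A primitive of `alternatingKernel s * iteratedChi X m s`. -/
noncomputable def kernelIterated (X : ℕ → ℂ) (m : ℕ) (s : ℂ) : ℂ :=
  kernelChi (m + 1) s - ∑ x ∈ Finset.HasAntidiagonal.antidiagonal m, X x.2 * kernelLog x.1 s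

theorem hasDerivAt_kernelIterated (X : ℕ → ℂ) (m : ℕ) {s : ℂ} (hs : s ∈ halfDisc) :
    HasDerivAt (kernelIterated X m) (alternatingKernel s * iteratedChi X m s) s := by
  refine HasDerivAt.congr_deriv ((hasDerivAt_kernelChi (m + 1) hs.2 (ne_zero_of_mem_halfDisc hs)).sub
    (HasDerivAt.fun_sum (u := Finset.HasAntidiagonal.antidiagonal m) fun x _ =>
      (hasDerivAt_kernelLog x.1 hs).const_mul (X x.2))) (Eq.symm ?_)
  rw [iteratedChi, mul_sub, Finset.mul_sum]
  congr 1
  refine Finset.sum_congr rfl fun x _ => ?_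
  ring

/-- Repeated integration by parts of the iterated integral of the alternating sums. -/
noncomputable def partsSum (X : ℕ → ℂ) (m : ℕ) (s : ℂ) : ℂ :=
  powSum (fun n => altCoeff m n / n) (cayley s) +
    2 * ∑ x ∈ Finset.HasAntidiagonal.antidiagonal m, powSum (altCoeff x.1) (cayley s) * iteratedChi X x.2 s

/-- The end term `2 F_m / (1 - s²)` of the telescoped sum cancels the derivative of the leading
series, leaving only the innermost kernel. -/
theorem hasDerivAt_partsSum (X : ℕ → ℂ) (m : ℕ) {s : ℂ} (hs : s ∈ halfDisc) :
    HasDerivAt (partsSum X m) (4 * (alternatingKernel s * iteratedChi X m s)) s := by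
  refine HasDerivAt.congr_deriv ((hasDerivAt_altCoeff_div_cayley m hs).add
    ((hasDerivAt_sum_antidiagonal (u := fun p z => powSum (altCoeff p) (cayley z))
      (v := iteratedChi X) (w := 1 / s) (hasDerivAt_altCoeff_zero_cayley hs)
      (fun i => hasDerivAt_altCoeff_succ_cayley i hs) (hasDerivAt_iteratedChi_zero X hs)
      (fun j => hasDerivAt_iteratedChi_succ X j hs) m).const_mul 2)) (Eq.symm ?_)
  ring

theorem partsSum_sub_eq (X : ℕ → ℂ) (m : ℕ) {s s' : ℂ} (hs : s ∈ halfDisc) (hs' : s' ∈ halfDisc) :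
    partsSum X m s - 4 * kernelIterated X m s = partsSum X m s' - 4 * kernelIterated X m s' := by
  have hd : ∀ z ∈ halfDisc,
      HasDerivAt (fun z => partsSum X m z - 4 * kernelIterated X m z) 0 z := fun z hz => by
    refine HasDerivAt.congr_deriv ((hasDerivAt_partsSum X m hz).sub ((hasDerivAt_kernelIterated X m hz).const_mul 4)) (Eq.symm ?_)
    ring
  exact isOpen_halfDisc.is_const_of_deriv_eq_zero convex_halfDisc.isPreconnected
    (fun z hz => (hd z hz).differentiableAt.differentiableWithinAt) (fun z hz => (hd z hz).deriv)
    hs hs'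

/-! ### Boundary behaviour along the approach paths -/

theorem powSum_polylogCoeff_mul (p : ℕ) (x s z : ℂ) :
    powSum (polylogCoeff p x) (s * z) = powSum (polylogCoeff p (x * s)) z := by
  rw [← powSum_mul_pow]
  refine congrArg (fun a => powSum a z) (funext fun n => ?_)
  rw [polylogCoeff, polylogCoeff, mul_pow]
  ring

theorem powSum_doubleCoeff_mul (q : ℕ) (x y s z : ℂ) :
    powSum (doubleCoeff 1 q x y) (s * z) = powSum (doubleCoeff 1 q (x * s) y) z := by
  rw [← powSum_mul_pow]
  refine congrArg (fun a => powSum a z) (funext fun n => ?_)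
  rw [doubleCoeff, doubleCoeff, polylogCoeff, polylogCoeff, mul_pow]
  ring

theorem eventually_stolzPath_mem : ∀ᶠ ε : ℝ in 𝓝[>] 0, stolzPath ε ∈ halfDisc := by
  filter_upwards [eventually_pos_lt_half] with ε hε
  refine ⟨?_, (norm_stolzPath_le hε.1 hε.2).trans_lt (by linarith [hε.1])⟩
  rw [stolzPath_re]
  linarith [hε.2]

theorem neg_I_mul_stolzPath_re (ε : ℝ) : (-Complex.I * stolzPath ε).re = ε := by
  simp [stolzPath]

theorem norm_neg_I_mul (z : ℂ) : ‖-Complex.I * z‖ = ‖z‖ := by simp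

theorem eventually_neg_I_mul_stolzPath_mem :
    ∀ᶠ ε : ℝ in 𝓝[>] 0, -Complex.I * stolzPath ε ∈ halfDisc := by
  filter_upwards [eventually_pos_lt_half] with ε hε
  refine ⟨?_, ?_⟩
  · rw [neg_I_mul_stolzPath_re]; exact hε.1
  · rw [norm_neg_I_mul]
    exact (norm_stolzPath_le hε.1 hε.2).trans_lt (by linarith [hε.1])

theorem tendsto_neg_I_mul_stolzPath :
    Tendsto (fun ε => -Complex.I * stolzPath ε) (𝓝[>] 0) (𝓝 (-Complex.I)) := by
  simpa using tendsto_stolzPath.const_mul (-Complex.I)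

/-- A product of an `O(ε)` and an `o(1 / ε)` tends to zero. -/
theorem tendsto_mul_zero_of_norm_le {g k : ℝ → ℂ} (hg : ∃ C : ℝ, ∀ᶠ ε : ℝ in 𝓝[>] 0, ‖g ε‖ ≤ C * ε)
    (hk : Tendsto (fun ε : ℝ => (ε : ℂ) * k ε) (𝓝[>] 0) (𝓝 0)) :
    Tendsto (fun ε => g ε * k ε) (𝓝[>] 0) (𝓝 0) := by
  obtain ⟨C, hC⟩ := hg
  have h := hk.norm.const_mul C
  rw [norm_zero, mul_zero] at h
  refine squeeze_zero_norm' ?_ h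
  filter_upwards [hC, self_mem_nhdsWithin] with ε h1 h2
  have h2' : (0 : ℝ) < ε := h2
  rw [norm_mul, norm_mul, Complex.norm_real, Real.norm_of_nonneg h2'.le, ← mul_assoc]
  gcongr

theorem tendsto_ofReal_mul_zero {k : ℝ → ℂ} {l : ℂ} (hk : Tendsto k (𝓝[>] 0) (𝓝 l)) :
    Tendsto (fun ε : ℝ => (ε : ℂ) * k ε) (𝓝[>] 0) (𝓝 0) := by
  have h : Tendsto (fun ε : ℝ => (ε : ℂ)) (𝓝[>] 0) (𝓝 0) := by
    simpa using (Complex.continuous_ofReal.tendsto 0).mono_left nhdsWithin_le_nhds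
  simpa using h.mul hk

theorem tendsto_polylogCoeff {p : ℕ} (hp : 1 ≤ p) {x : ℂ} (hx : ‖x‖ ≤ 1) :
    Tendsto (polylogCoeff p x) atTop (𝓝 0) := by
  refine squeeze_zero_norm (norm_polylogCoeff_le_inv_pow p hx) ?_
  exact tendsto_inv_atTop_zero.comp ((tendsto_pow_atTop (Nat.one_le_iff_ne_zero.1 hp)).comp
    tendsto_natCast_atTop_atTop)

theorem tendsto_ofReal_mul_polylog {p : ℕ} (hp : 1 ≤ p) {x : ℂ} (hx : ‖x‖ ≤ 1) :
    Tendsto (fun ε : ℝ => (ε : ℂ) * powSum (polylogCoeff p x) (stolzPath ε)) (𝓝[>] 0) (𝓝 0) := by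
  refine tendsto_mul_powSum_zero (tendsto_polylogCoeff hp hx) (c := 1 / 2) (by norm_num) ?_
  filter_upwards [eventually_pos_lt_half] with ε hε
  linarith [norm_stolzPath_le hε.1 hε.2]

theorem tendsto_polylog_stolzPath {p : ℕ} {x : ℂ} (hx : ‖x‖ ≤ 1) (h : 2 ≤ p ∨ 1 ≤ p ∧ x ≠ 1) :
    Tendsto (fun ε => powSum (polylogCoeff p x) (stolzPath ε)) (𝓝[>] 0)
      (𝓝 (polylog ![p] ![x])) :=
  (seriesTendsto_polylog hx h).powSum_stolzPath

theorem tendsto_double_stolzPath {q : ℕ} (hq : 2 ≤ q) {x y : ℂ} (hx : ‖x‖ ≤ 1)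
    (hx1 : x ≠ 1) (hy : ‖y‖ ≤ 1) :
    Tendsto (fun ε => powSum (doubleCoeff 1 q x y) (stolzPath ε)) (𝓝[>] 0)
      (𝓝 (polylog ![1, q] ![x, y])) :=
  (seriesTendsto_double_one hq hx hx1 hy).powSum_stolzPath

/-- The coefficients of the difference are minus the tails divided by `n`, which are summable
although the harmonic series diverges. -/
theorem tendsto_double_regularized {q : ℕ} (hq : 2 ≤ q) {y : ℂ} (hy : ‖y‖ ≤ 1) :
    Tendsto (fun ε => powSum (doubleCoeff 1 q 1 y) (stolzPath ε) -
      polylog ![q] ![y] * powSum (polylogCoeff 1 1) (stolzPath ε)) (𝓝[>] 0)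
      (𝓝 (-(polylog ![q, 1] ![y, 1] + polylog ![q + 1] ![y]))) := by
  have h := ((summable_norm_polylogTail_div hq hy).of_norm.seriesTendsto.powSum_stolzPath).neg
  rw [tsum_polylogTail_div hq hy] at h
  refine h.congr' ?_
  filter_upwards [eventually_stolzPath_mem] with ε hε
  have h1 := summable_of_norm_le (norm_doubleCoeff_one_le (q := q) (x := 1) (by simp) hy) hε.2
  have h2 := summable_of_norm_le (norm_polylogCoeff_le_one 1 (x := 1) (by simp)) hε.2
  rw [powSum, powSum, powSum, ← tsum_mul_left, ← h1.tsum_sub (h2.mul_left _), ← tsum_neg]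
  refine tsum_congr fun n => ?_
  rw [doubleCoeff, polylogTail, polylogCoeff]
  simp only [one_pow, pow_one]
  ring

theorem I_ne_one : Complex.I ≠ 1 := fun h => by simpa using congrArg Complex.im h

theorem neg_I_ne_one : -Complex.I ≠ 1 := fun h => by simpa using congrArg Complex.im h

theorem neg_one_ne_one_complex : (-1 : ℂ) ≠ 1 := by norm_num

/-! ### Limits at `s = 1` -/

theorem tendsto_logPow_at_one (l : ℕ) : Tendsto (fun ε => logPow l (stolzPath ε)) (𝓝[>] 0)
    (𝓝 ((Complex.I * (Real.pi : ℂ) / 2) ^ l / (l.factorial : ℂ))) := by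
  have h1 : Tendsto (fun ε => Complex.log (stolzPath ε)) (𝓝[>] 0) (𝓝 0) := by
    rw [← Complex.log_one]
    exact tendsto_stolzPath.clog (by simp)
  simpa [logPow] using ((h1.add_const (Complex.I * (Real.pi : ℂ) / 2)).pow l).div_const
    (l.factorial : ℂ)

theorem tendsto_kernelPolylog_at_one {p : ℕ} (hp : 1 ≤ p) :
    Tendsto (fun ε => kernelPolylog p (stolzPath ε)) (𝓝[>] 0)
      (𝓝 (-(1 - 1 / 2 ^ p) * polylog ![p] ![-1])) := by
  have h := (tendsto_polylog_stolzPath (p := p) (x := -1) (by simp)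
      (Or.inr ⟨hp, neg_one_ne_one_complex⟩)).neg.add
    (((tendsto_polylog_stolzPath (p := p) (x := Complex.I) (by simp)
      (Or.inr ⟨hp, I_ne_one⟩)).add
    (tendsto_polylog_stolzPath (p := p) (x := -Complex.I) (by simp)
      (Or.inr ⟨hp, neg_I_ne_one⟩))).div_const 2)
  rw [polylog_I_add_polylog_neg_I hp] at h
  refine h.trans_eq ?_
  congr 1
  ring

theorem tendsto_kernelLog_at_one (l : ℕ) : Tendsto (fun ε => kernelLog l (stolzPath ε)) (𝓝[>] 0)
    (𝓝 (∑ x ∈ Finset.HasAntidiagonal.antidiagonal l,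
      ((-1) ^ x.1 * (-(1 - 1 / 2 ^ (x.1 + 1)) * polylog ![x.1 + 1] ![-1])) *
        ((Complex.I * (Real.pi : ℂ) / 2) ^ x.2 / (x.2.factorial : ℂ)))) :=
  tendsto_finsetSum _ fun x _ =>
    ((tendsto_kernelPolylog_at_one (Nat.succ_pos x.1)).const_mul _).mul (tendsto_logPow_at_one x.2)

theorem tendsto_kernelChi_at_one {q : ℕ} (hq : 2 ≤ q) :
    Tendsto (fun ε => kernelChi q (stolzPath ε)) (𝓝[>] 0)
      (𝓝 ((-polylog ![1, q] ![-1, -1] + polylog ![1, q] ![-1, 1]) / 2 +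
        (polylog ![1, q] ![Complex.I, -Complex.I] - polylog ![1, q] ![Complex.I, Complex.I] +
          polylog ![1, q] ![-Complex.I, Complex.I] -
          polylog ![1, q] ![-Complex.I, -Complex.I]) / 4)) := by
  have n1 : ‖(-1 : ℂ)‖ ≤ 1 := by simp
  have n2 : ‖(1 : ℂ)‖ ≤ 1 := by simp
  have n3 : ‖Complex.I‖ ≤ 1 := by simp
  have n4 : ‖-Complex.I‖ ≤ 1 := by simp
  have a1 := neg_one_ne_one_complex
  have a2 := I_ne_one
  have a3 := neg_I_ne_one
  exact (((tendsto_double_stolzPath hq n1 a1 n1).neg.add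
    (tendsto_double_stolzPath hq n1 a1 n2)).div_const 2).add
    (((((tendsto_double_stolzPath hq n3 a2 n4).sub (tendsto_double_stolzPath hq n3 a2 n3)).add
    (tendsto_double_stolzPath hq n4 a3 n3)).sub (tendsto_double_stolzPath hq n4 a3 n4)).div_const 4)

theorem tendsto_kernelIterated_at_one (X : ℕ → ℂ) {m : ℕ} (hm : 1 ≤ m) :
    Tendsto (fun ε => kernelIterated X m (stolzPath ε)) (𝓝[>] 0)
      (𝓝 (((-polylog ![1, m + 1] ![-1, -1] + polylog ![1, m + 1] ![-1, 1]) / 2 +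
        (polylog ![1, m + 1] ![Complex.I, -Complex.I] -
          polylog ![1, m + 1] ![Complex.I, Complex.I] +
          polylog ![1, m + 1] ![-Complex.I, Complex.I] -
          polylog ![1, m + 1] ![-Complex.I, -Complex.I]) / 4) -
        ∑ x ∈ Finset.HasAntidiagonal.antidiagonal m, X x.2 *
          ∑ y ∈ Finset.HasAntidiagonal.antidiagonal x.1,
            ((-1) ^ y.1 * (-(1 - 1 / 2 ^ (y.1 + 1)) * polylog ![y.1 + 1] ![-1])) *
              ((Complex.I * (Real.pi : ℂ) / 2) ^ y.2 / (y.2.factorial : ℂ)))) :=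
  (tendsto_kernelChi_at_one (by omega)).sub
    (tendsto_finsetSum _ fun x _ => (tendsto_kernelLog_at_one x.1).const_mul _)

theorem tendsto_cayley_at_one : Tendsto (fun ε => cayley (stolzPath ε)) (𝓝[>] 0) (𝓝 0) := by
  have h : ContinuousAt cayley 1 := (hasDerivAt_cayley (by norm_num)).continuousAt
  have h1 : cayley 1 = 0 := by simp [cayley]
  rw [← h1]
  exact h.tendsto.comp tendsto_stolzPath

theorem norm_cayley_stolzPath_le {ε : ℝ} (h0 : 0 < ε) (h1 : ε < 1 / 2) :
    ‖cayley (stolzPath ε)‖ ≤ 2 * ε := by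
  have h2 : 1 ≤ ‖1 + stolzPath ε‖ := by
    refine le_trans ?_ (Complex.re_le_norm _)
    rw [Complex.add_re, stolzPath_re, Complex.one_re]
    linarith
  have h3 : ‖1 - stolzPath ε‖ ≤ 2 * ε := by
    have : 1 - stolzPath ε = ε * (1 - Complex.I) := by rw [stolzPath]; ring
    rw [this, norm_mul, Complex.norm_real, Real.norm_of_nonneg h0.le]
    have : ‖1 - Complex.I‖ ≤ 2 := by
      refine (norm_sub_le _ _).trans ?_
      rw [norm_one, Complex.norm_I]; norm_num
    nlinarith
  rw [cayley, norm_div]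
  exact (div_le_self (norm_nonneg _) h2).trans h3

/-- Near `s = 1` the variable `t` is `O(ε)` and `F_q` vanishes at `0`; this outweighs the possible
divergence of `iteratedChi` there, which is `o(1/ε)`. -/
theorem exists_norm_altCoeff_cayley_le (q : ℕ) : ∃ C : ℝ, ∀ᶠ ε : ℝ in 𝓝[>] 0,
    ‖powSum (altCoeff q) (cayley (stolzPath ε))‖ ≤ C * ε := by
  obtain ⟨B, hB⟩ := exists_norm_altCoeff_le_const q
  have h0 : powSum (altCoeff q) 0 = 0 := by
    rw [powSum, ← tsum_zero (α := ℂ) (β := ℕ)]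
    refine tsum_congr fun n => ?_
    rcases n with _ | n
    · simp [altCoeff_zero_right]
    · simp
  have hO := (hasDerivAt_powSum hB (z := 0) (by simp)).isBigO_sub
  obtain ⟨C, hC⟩ := (hO.comp_tendsto tendsto_cayley_at_one).bound
  refine ⟨|C| * 2, ?_⟩
  filter_upwards [hC, eventually_pos_lt_half] with ε h1 h2
  simp only [Function.comp, h0, sub_zero] at h1
  calc _ ≤ C * ‖cayley (stolzPath ε)‖ := h1
    _ ≤ |C| * (2 * ε) := by
      gcongr
      · exact le_abs_self C
      · exact norm_cayley_stolzPath_le h2.1 h2.2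
    _ = _ := by ring

theorem tendsto_ofReal_mul_iteratedChi_at_one (X : ℕ → ℂ) (j : ℕ) :
    Tendsto (fun ε : ℝ => (ε : ℂ) * iteratedChi X j (stolzPath ε)) (𝓝[>] 0) (𝓝 0) := by
  have h1 := ((tendsto_ofReal_mul_polylog (Nat.succ_pos j) (x := 1) (by simp)).sub
    (tendsto_ofReal_mul_polylog (Nat.succ_pos j) (x := -1) (by simp))).div_const 2
  have h2 := tendsto_ofReal_mul_zero (tendsto_finsetSum
    (Finset.HasAntidiagonal.antidiagonal j) fun x _ =>
      (tendsto_logPow_at_one x.1).const_mul (X x.2))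
  have h3 := h1.sub h2
  simp only [sub_zero, zero_div] at h3
  refine h3.congr fun ε => ?_
  rw [iteratedChi, legendreChi]
  ring

theorem tendsto_partsSum_at_one (X : ℕ → ℂ) (m : ℕ) :
    Tendsto (fun ε => partsSum X m (stolzPath ε)) (𝓝[>] 0) (𝓝 0) := by
  have h0 : powSum (fun n => altCoeff m n / n) 0 = 0 := by
    rw [powSum, ← tsum_zero (α := ℂ) (β := ℕ)]
    refine tsum_congr fun n => ?_
    rcases n with _ | n <;> simp
  have h1 := tendsto_powSum_of_summable (summable_norm_altCoeff_div m)
    (by filter_upwards [eventually_stolzPath_mem] with ε hε using (norm_cayley_lt_one hε).le)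
    tendsto_cayley_at_one
  have h2 := (tendsto_finsetSum (Finset.HasAntidiagonal.antidiagonal m) fun x _ =>
    tendsto_mul_zero_of_norm_le (exists_norm_altCoeff_cayley_le x.1)
      (tendsto_ofReal_mul_iteratedChi_at_one X x.2)).const_mul 2
  have h3 := h1.add h2
  simp only [h0, Finset.sum_const_zero, mul_zero, add_zero] at h3
  exact h3

/-! ### Limits at `s = -i` -/

theorem tendsto_logPow_at_neg_I (l : ℕ) :
    Tendsto (fun ε => logPow l (-Complex.I * stolzPath ε)) (𝓝[>] 0)
      (𝓝 (if l = 0 then 1 else 0)) := by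
  have h1 : Tendsto (fun ε => Complex.log (-Complex.I * stolzPath ε)) (𝓝[>] 0)
      (𝓝 (Complex.log (-Complex.I))) :=
    tendsto_neg_I_mul_stolzPath.clog (by simp [Complex.slitPlane])
  rw [Complex.log_neg_I] at h1
  have h2 := ((h1.add_const (Complex.I * (Real.pi : ℂ) / 2)).pow l).div_const (l.factorial : ℂ)
  have h3 : -(Real.pi / 2 : ℂ) * Complex.I + Complex.I * (Real.pi : ℂ) / 2 = 0 := by ring
  rw [h3] at h2
  refine h2.trans_eq ?_
  congr 1
  split_ifs with h
  · simp [h]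
  · simp [h]

/-- The path has constant velocity `c`, so a convergent `g'` bounds the derivative along it. The
linear rate is needed because the factors multiplied by `g` are only known to be `o(1/ε)`. -/
theorem exists_norm_le_of_tendsto_deriv {g : ℂ → ℂ} {g' : ℂ → ℂ} {d : ℂ}
    (hg : ∀ s ∈ halfDisc, HasDerivAt g (g' s) s)
    (hd : Tendsto (fun ε => g' (-Complex.I * stolzPath ε)) (𝓝[>] 0) (𝓝 d))
    (h0 : Tendsto (fun ε => g (-Complex.I * stolzPath ε)) (𝓝[>] 0) (𝓝 0)) :
    ∃ C : ℝ, ∀ᶠ ε : ℝ in 𝓝[>] 0, ‖g (-Complex.I * stolzPath ε)‖ ≤ C * ε := by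
  set c : ℂ := -Complex.I * (-1 + Complex.I) with hc
  have hpath : ∀ ε : ℝ, HasDerivAt (fun ε : ℝ => -Complex.I * stolzPath ε) c ε := fun ε => by
    have h1 : HasDerivAt (fun ε : ℝ => (ε : ℂ)) 1 ε := Complex.ofRealCLM.hasDerivAt
    refine HasDerivAt.congr_deriv
      (((h1.const_sub 1).add (h1.mul_const Complex.I)).const_mul (-Complex.I)) ?_
    rw [hc, one_mul]
  refine ⟨‖d * c‖ + 1, exists_norm_le_mul_of_hasDerivAt
    (g' := fun ε => g' (-Complex.I * stolzPath ε) * c) ?_ ?_ h0⟩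
  · filter_upwards [eventually_neg_I_mul_stolzPath_mem] with ε hε
    exact (hg _ hε).comp ε (hpath ε)
  · exact (hd.mul_const c).norm.eventually_le_const (lt_add_one _)

theorem exists_norm_logPow_succ_le (l : ℕ) : ∃ C : ℝ, ∀ᶠ ε : ℝ in 𝓝[>] 0,
    ‖logPow (l + 1) (-Complex.I * stolzPath ε)‖ ≤ C * ε := by
  have hI : -Complex.I ≠ 0 := neg_ne_zero.2 Complex.I_ne_zero
  exact exists_norm_le_of_tendsto_deriv (fun s hs => hasDerivAt_logPow_succ l hs.1)
    ((((tendsto_const_nhds (x := (1 : ℂ))).div tendsto_neg_I_mul_stolzPath hI)).mul (tendsto_logPow_at_neg_I l))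
    (by simpa using tendsto_logPow_at_neg_I (l + 1))

/-- The values `∑_{n odd} (-i) ^ n / n ^ (r + 1)`. -/
noncomputable def chiNegI (r : ℕ) : ℂ := -Complex.I * (dirichletBeta (r + 1) : ℂ)

theorem chiNegI_eq (r : ℕ) :
    chiNegI r = (polylog ![r + 1] ![-Complex.I] - polylog ![r + 1] ![Complex.I]) / 2 := by
  rw [chiNegI, (tendsto_betaPartial (Nat.succ_pos r)).2]
  linear_combination (polylog ![r + 1] ![Complex.I] - polylog ![r + 1] ![-Complex.I]) / 2 *
    Complex.I_sq

/-- All positive powers of `log s + iπ/2` vanish at `-i`, so only the constant `chiNegI j` is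
subtracted, and it is the limit of the odd polylogarithm there. -/
theorem tendsto_iteratedChi_at_neg_I (j : ℕ) :
    Tendsto (fun ε => iteratedChi chiNegI j (-Complex.I * stolzPath ε)) (𝓝[>] 0) (𝓝 0) := by
  have h1 := ((tendsto_polylog_stolzPath (p := j + 1) (x := -Complex.I) (by simp)
      (Or.inr ⟨Nat.succ_pos j, neg_I_ne_one⟩)).sub
    (tendsto_polylog_stolzPath (p := j + 1) (x := Complex.I) (by simp)
      (Or.inr ⟨Nat.succ_pos j, I_ne_one⟩))).div_const 2
  have h2 := tendsto_finsetSum (Finset.HasAntidiagonal.antidiagonal j) fun x _ =>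
      (tendsto_logPow_at_neg_I x.1).const_mul (chiNegI x.2)
  have h3 : ∑ x ∈ Finset.HasAntidiagonal.antidiagonal j,
      chiNegI x.2 * (if x.1 = 0 then 1 else 0) = chiNegI j := by
    rw [Finset.sum_eq_single (0, j)]
    · simp
    · rintro ⟨a, b⟩ hx hne
      rw [if_neg, mul_zero]
      rintro rfl
      exact hne (by simpa using hx)
    · intro h; exact absurd (by simp) h
  rw [h3] at h2
  have h4 := h1.sub h2
  rw [← chiNegI_eq, sub_self] at h4
  refine h4.congr fun ε => ?_
  rw [iteratedChi, legendreChi, powSum_polylogCoeff_mul, powSum_polylogCoeff_mul, one_mul,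
    neg_mul_neg, one_mul]

theorem exists_norm_iteratedChi_le (j : ℕ) : ∃ C : ℝ, ∀ᶠ ε : ℝ in 𝓝[>] 0,
    ‖iteratedChi chiNegI j (-Complex.I * stolzPath ε)‖ ≤ C * ε := by
  have hI : -Complex.I ≠ 0 := neg_ne_zero.2 Complex.I_ne_zero
  cases j with
  | zero =>
    refine exists_norm_le_of_tendsto_deriv (fun s hs => hasDerivAt_iteratedChi_zero _ hs)
      ((tendsto_const_nhds (x := (1 : ℂ))).div ((tendsto_neg_I_mul_stolzPath.pow 2).const_sub 1) ?_)
      (tendsto_iteratedChi_at_neg_I 0)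
    rw [neg_sq, Complex.I_sq]
    norm_num
  | succ j =>
    exact exists_norm_le_of_tendsto_deriv (fun s hs => hasDerivAt_iteratedChi_succ _ j hs)
      ((((tendsto_const_nhds (x := (1 : ℂ))).div tendsto_neg_I_mul_stolzPath hI)).mul (tendsto_iteratedChi_at_neg_I j))
      (tendsto_iteratedChi_at_neg_I (j + 1))

/-- The substitution sends `-i` to `i`. Each product pairs an `O(ε)` factor `iteratedChi` with an
`o(1/ε)` factor `F_q`, so only the leading series contributes. -/
theorem tendsto_partsSum_at_neg_I (m : ℕ) :
    Tendsto (fun ε => partsSum chiNegI m (-Complex.I * stolzPath ε)) (𝓝[>] 0)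
      (𝓝 (powSum (fun n => altCoeff m n / n) Complex.I)) := by
  have hne : 1 + -Complex.I ≠ 0 := fun h => by simpa using congrArg Complex.im h
  have hval : cayley (-Complex.I) = Complex.I := by
    rw [cayley, div_eq_iff hne]
    linear_combination Complex.I_sq
  have hlim : Tendsto (fun ε => cayley (-Complex.I * stolzPath ε)) (𝓝[>] 0) (𝓝 Complex.I) := by
    have h := (hasDerivAt_cayley hne).continuousAt.tendsto.comp tendsto_neg_I_mul_stolzPath
    rwa [hval] at h
  have h1 := tendsto_powSum_of_summable (summable_norm_altCoeff_div m)
    (by filter_upwards [eventually_neg_I_mul_stolzPath_mem] with ε hε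
        exact (norm_cayley_lt_one hε).le) hlim
  have hb : ∀ᶠ ε : ℝ in 𝓝[>] 0, ‖cayley (-Complex.I * stolzPath ε)‖ ≤ 1 - 1 / 2 * ε := by
    filter_upwards [eventually_neg_I_mul_stolzPath_mem] with ε hε
    have := norm_cayley_le hε.1 hε.2.le
    rw [neg_I_mul_stolzPath_re] at this
    linarith
  have h2 := (tendsto_finsetSum (Finset.HasAntidiagonal.antidiagonal m) fun x _ =>
    tendsto_mul_zero_of_norm_le (exists_norm_iteratedChi_le x.2)
      (tendsto_mul_powSum_zero (tendsto_altCoeff x.1) (by norm_num) hb)).const_mul 2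
  have h3 := h1.add h2
  simp only [Finset.sum_const_zero, mul_zero, add_zero] at h3
  refine h3.congr fun ε => ?_
  rw [partsSum]
  congr 2
  exact Finset.sum_congr rfl fun x _ => mul_comm _ _

theorem kernelPolylog_neg_I_mul (p : ℕ) (z : ℂ) : kernelPolylog p (-Complex.I * z) =
    -powSum (polylogCoeff p Complex.I) z +
      (powSum (polylogCoeff p 1) z + powSum (polylogCoeff p (-1)) z) / 2 := by
  rw [kernelPolylog, powSum_polylogCoeff_mul, powSum_polylogCoeff_mul, powSum_polylogCoeff_mul]
  simp

theorem tendsto_ofReal_mul_kernelPolylog {p : ℕ} (hp : 1 ≤ p) :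
    Tendsto (fun ε : ℝ => (ε : ℂ) * kernelPolylog p (-Complex.I * stolzPath ε)) (𝓝[>] 0)
      (𝓝 0) := by
  have h := (tendsto_ofReal_mul_polylog hp (x := Complex.I) (by simp)).neg.add
    (((tendsto_ofReal_mul_polylog hp (x := 1) (by simp)).add
    (tendsto_ofReal_mul_polylog hp (x := -1) (by simp))).div_const 2)
  simp only [neg_zero, add_zero, zero_div] at h
  refine h.congr fun ε => ?_
  rw [kernelPolylog_neg_I_mul]
  ring

theorem tendsto_kernelPolylog_at_neg_I {p : ℕ} (hp : 2 ≤ p) :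
    Tendsto (fun ε => kernelPolylog p (-Complex.I * stolzPath ε)) (𝓝[>] 0)
      (𝓝 (-polylog ![p] ![Complex.I] + (polylog ![p] ![1] + polylog ![p] ![-1]) / 2)) := by
  refine ((tendsto_polylog_stolzPath (p := p) (x := Complex.I) (by simp) (Or.inl hp)).neg.add
    (((tendsto_polylog_stolzPath (p := p) (x := 1) (by simp) (Or.inl hp)).add
    (tendsto_polylog_stolzPath (p := p) (x := -1) (by simp) (Or.inl hp))).div_const 2)).congr
    fun ε => ?_
  rw [kernelPolylog_neg_I_mul]

/-- The logarithmically divergent `kernelPolylog 1` occurs only with a positive power of `log s +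
iπ/2`, which kills it; the term without a logarithm has weight `l + 2` and converges. -/
theorem tendsto_kernelLog_succ_at_neg_I (l : ℕ) :
    Tendsto (fun ε => kernelLog (l + 1) (-Complex.I * stolzPath ε)) (𝓝[>] 0)
      (𝓝 ((-1) ^ (l + 1) * (-polylog ![l + 2] ![Complex.I] +
        (polylog ![l + 2] ![1] + polylog ![l + 2] ![-1]) / 2))) := by
  have h1 := (tendsto_kernelPolylog_at_neg_I (p := l + 2) (by omega)).const_mul ((-1) ^ (l + 1))
  have h2 := tendsto_finsetSum (Finset.HasAntidiagonal.antidiagonal l) fun x _ =>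
    (tendsto_mul_zero_of_norm_le (exists_norm_logPow_succ_le x.2)
      (tendsto_ofReal_mul_kernelPolylog (Nat.succ_pos x.1))).const_mul ((-1) ^ x.1)
  have h3 := h1.add h2
  simp only [Finset.sum_const_zero, mul_zero, add_zero] at h3
  refine h3.congr fun ε => ?_
  rw [kernelLog, Finset.Nat.sum_antidiagonal_succ']
  simp only [logPow, pow_zero, Nat.factorial_zero, Nat.cast_one, div_one, mul_one]
  congr 1
  refine Finset.sum_congr rfl fun x _ => ?_
  ring

/-- After rotation the pairs `(i, -i)` and `(i, i)` become `(1, -i)` and `(1, i)`. Their divergence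
is `(Li_{m+1}(-i) - Li_{m+1}(i)) / 4` times the `Li_1(1)` series, exactly the divergence of `chiNegI
m * kernelPolylog 1`. -/
theorem tendsto_kernelChi_sub_at_neg_I {m : ℕ} (hm : 1 ≤ m) :
    Tendsto (fun ε => kernelChi (m + 1) (-Complex.I * stolzPath ε) -
      chiNegI m * kernelPolylog 1 (-Complex.I * stolzPath ε)) (𝓝[>] 0)
      (𝓝 ((-polylog ![1, m + 1] ![Complex.I, -1] + polylog ![1, m + 1] ![Complex.I, 1]) / 2 +
        (-(polylog ![m + 1, 1] ![-Complex.I, 1] + polylog ![m + 1 + 1] ![-Complex.I]) -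
          -(polylog ![m + 1, 1] ![Complex.I, 1] + polylog ![m + 1 + 1] ![Complex.I]) +
          polylog ![1, m + 1] ![-1, Complex.I] - polylog ![1, m + 1] ![-1, -Complex.I]) / 4 -
        chiNegI m * (-polylog ![1] ![Complex.I] + polylog ![1] ![-1] / 2))) := by
  have n1 : ‖(-1 : ℂ)‖ ≤ 1 := by simp
  have n2 : ‖(1 : ℂ)‖ ≤ 1 := by simp
  have n3 : ‖Complex.I‖ ≤ 1 := by simp
  have n4 : ‖-Complex.I‖ ≤ 1 := by simp
  have a1 := neg_one_ne_one_complex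
  have a2 := I_ne_one
  have hq : 2 ≤ m + 1 := by omega
  have h := ((((tendsto_double_stolzPath hq n3 a2 n1).neg.add
    (tendsto_double_stolzPath hq n3 a2 n2)).div_const 2).add
    (((((tendsto_double_regularized hq n4).sub (tendsto_double_regularized hq n3)).add
    (tendsto_double_stolzPath hq n1 a1 n3)).sub
      (tendsto_double_stolzPath hq n1 a1 n4)).div_const 4)).sub
    (((tendsto_polylog_stolzPath (p := 1) n3 (Or.inr ⟨le_rfl, a2⟩)).neg.add
      ((tendsto_polylog_stolzPath (p := 1) n1 (Or.inr ⟨le_rfl, a1⟩)).div_const 2)).const_mul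
      (chiNegI m))
  refine h.congr fun ε => ?_
  have e1 : Complex.I * -Complex.I = 1 := by simp
  have e2 : -Complex.I * -Complex.I = -1 := by simp
  have e3 : -1 * -Complex.I = Complex.I := by ring
  rw [kernelChi, kernelPolylog_neg_I_mul]
  simp only [powSum_doubleCoeff_mul, e1, e2, e3]
  rw [chiNegI_eq]
  ring

theorem tendsto_kernelIterated_at_neg_I (q : ℕ) :
    Tendsto (fun ε => kernelIterated chiNegI (q + 1) (-Complex.I * stolzPath ε)) (𝓝[>] 0)
      (𝓝 (((-polylog ![1, q + 1 + 1] ![Complex.I, -1] +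
          polylog ![1, q + 1 + 1] ![Complex.I, 1]) / 2 +
        (-(polylog ![q + 1 + 1, 1] ![-Complex.I, 1] + polylog ![q + 1 + 1 + 1] ![-Complex.I]) -
          -(polylog ![q + 1 + 1, 1] ![Complex.I, 1] + polylog ![q + 1 + 1 + 1] ![Complex.I]) +
          polylog ![1, q + 1 + 1] ![-1, Complex.I] -
          polylog ![1, q + 1 + 1] ![-1, -Complex.I]) / 4 -
        chiNegI (q + 1) * (-polylog ![1] ![Complex.I] + polylog ![1] ![-1] / 2)) -
        ∑ x ∈ Finset.HasAntidiagonal.antidiagonal q, chiNegI x.2 *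
          ((-1) ^ (x.1 + 1) * (-polylog ![x.1 + 2] ![Complex.I] +
            (polylog ![x.1 + 2] ![1] + polylog ![x.1 + 2] ![-1]) / 2)))) := by
  refine ((tendsto_kernelChi_sub_at_neg_I (Nat.succ_pos q)).sub
    (tendsto_finsetSum (Finset.HasAntidiagonal.antidiagonal q) fun x _ =>
      (tendsto_kernelLog_succ_at_neg_I x.1).const_mul (chiNegI x.2))).congr fun ε => ?_
  -- The term with `kernelLog 0` is split off: it alone diverges, and it regularises `kernelChi`.
  rw [kernelIterated, Finset.Nat.sum_antidiagonal_succ]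
  have : kernelLog 0 (-Complex.I * stolzPath ε) =
      kernelPolylog 1 (-Complex.I * stolzPath ε) := by
    simp [kernelLog, logPow]
  rw [this]
  ring

/-! ### Assembling the formula -/

theorem sum_antidiagonal_triple {R : Type*} [AddCommMonoid R] (f : ℕ → ℕ → ℕ → R) (m : ℕ) :
    ∑ x ∈ Finset.HasAntidiagonal.antidiagonal m,
      ∑ y ∈ Finset.HasAntidiagonal.antidiagonal x.1, f y.2 y.1 x.2 =
    ∑ u ∈ Finset.HasAntidiagonal.antidiagonal m,
      ∑ v ∈ Finset.HasAntidiagonal.antidiagonal u.2, f u.1 v.1 v.2 := by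
  rw [Finset.sum_sigma', Finset.sum_sigma']
  refine Finset.sum_bij' (fun x _ => ⟨(x.2.2, x.2.1 + x.1.2), (x.2.1, x.1.2)⟩)
    (fun u _ => ⟨(u.2.1 + u.1.1, u.2.2), (u.2.1, u.1.1)⟩) ?_ ?_ ?_ ?_ ?_
  · rintro ⟨⟨a, b⟩, c, d⟩ h
    simp only [Finset.mem_sigma, Finset.HasAntidiagonal.mem_antidiagonal] at h ⊢
    obtain ⟨rfl, rfl⟩ := h
    exact ⟨by ring, trivial⟩
  · rintro ⟨⟨a, b⟩, c, d⟩ h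
    simp only [Finset.mem_sigma, Finset.HasAntidiagonal.mem_antidiagonal] at h ⊢
    obtain ⟨rfl, rfl⟩ := h
    exact ⟨by ring, trivial⟩
  · rintro ⟨⟨a, b⟩, c, d⟩ h
    simp only [Finset.mem_sigma, Finset.HasAntidiagonal.mem_antidiagonal] at h
    obtain ⟨rfl, rfl⟩ := h
    rfl
  · rintro ⟨⟨a, b⟩, c, d⟩ h
    simp only [Finset.mem_sigma, Finset.HasAntidiagonal.mem_antidiagonal] at h
    obtain ⟨rfl, rfl⟩ := h
    rfl
  · intro x _; rfl

theorem mainTheorem7 (m : ℕ) (hm : 1 ≤ m) :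
    -- all the series involved converge
    SeqConverges (multSPartial (signsBarBar m) (args21 m)) ∧
    (∀ s : ℕ, 1 ≤ s → SeqConverges (betaPartial s)) ∧
    (∀ s : ℕ, 1 ≤ s → ∀ x ∈ ({-1, Complex.I} : Set ℂ), SeqConverges (polylogPartial ![s] ![x])) ∧
    (∀ s : ℕ, 2 ≤ s → SeqConverges (polylogPartial ![s] ![(1 : ℂ)])) ∧
    (∀ x ∈ ({-1, Complex.I, -Complex.I} : Set ℂ),
      ∀ y ∈ ({1, -1, Complex.I, -Complex.I} : Set ℂ),
        SeqConverges (polylogPartial ![1, m + 1] ![x, y])) ∧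
    (∀ x ∈ ({Complex.I, -Complex.I} : Set ℂ),
      SeqConverges (polylogPartial ![m + 1, 1] ![x, 1])) ∧
    -- the evaluation
    ((multS (signsBarBar m) (args21 m) : ℝ) : ℂ) =
      (if Odd m then Complex.I else 1) *
        (2 * Complex.I * (dirichletBeta (m + 2) : ℂ)
          -- sum over `k + p + r = m` with `k = u.1`, `p = v.1`, `r = v.2`
          + ∑ u ∈ Finset.HasAntidiagonal.antidiagonal m, ∑ v ∈ Finset.HasAntidiagonal.antidiagonal u.2,
              2 * Complex.I * (-1) ^ v.1 * (dirichletBeta (v.2 + 1) : ℂ)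
                * (2 - 1 / 2 ^ v.1) * polylog ![v.1 + 1] ![-1]
                * (1 / (Nat.factorial u.1 : ℂ)) * (Complex.I * (Real.pi : ℂ) / 2) ^ u.1
          -- sum over `p + r = m` with `p = v.1`, `r = v.2`
          + ∑ v ∈ Finset.HasAntidiagonal.antidiagonal m,
              2 * Complex.I * (-1) ^ (v.1 + 1) * (dirichletBeta (v.2 + 1) : ℂ)
                * (2 * polylog ![v.1 + 1] ![Complex.I]
                    - (if 1 ≤ v.1 then polylog ![v.1 + 1] ![1] else 0)
                    - polylog ![v.1 + 1] ![-1])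
          + 2 * polylog ![1, m + 1] ![Complex.I, 1]
          - 2 * polylog ![1, m + 1] ![-1, 1]
          + 2 * polylog ![1, m + 1] ![-1, -1]
          - 2 * polylog ![1, m + 1] ![Complex.I, -1]
          + (polylog ![1, m + 1] ![-Complex.I, -Complex.I]
              + polylog ![1, m + 1] ![-1, Complex.I])
          + (-polylog ![1, m + 1] ![Complex.I, -Complex.I]
              + polylog ![m + 1, 1] ![Complex.I, 1])
          + (-polylog ![m + 1, 1] ![-Complex.I, 1]
              - polylog ![1, m + 1] ![-1, -Complex.I]
              - polylog ![1, m + 1] ![-Complex.I, Complex.I]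
              + polylog ![1, m + 1] ![Complex.I, Complex.I])) := by
  obtain ⟨hconv, hval⟩ := tendsto_multSPartial hm
  refine ⟨hconv, fun s hs => (tendsto_betaPartial hs).1, ?_, ?_, ?_, ?_, ?_⟩
  · intro s hs x hx
    have hx' : ‖x‖ ≤ 1 ∧ x ≠ 1 := by
      rcases hx with rfl | rfl
      · exact ⟨by simp, neg_one_ne_one_complex⟩
      · exact ⟨by simp, I_ne_one⟩
    exact ⟨_, ((seriesTendsto_polylog hx'.1 (Or.inr ⟨hs, hx'.2⟩)).polylog_one hs).1⟩
  · intro s hs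
    exact ⟨_, ((seriesTendsto_polylog (by simp) (Or.inl hs)).polylog_one (by omega)).1⟩
  · intro x hx y hy
    have hx' : ‖x‖ ≤ 1 ∧ x ≠ 1 := by
      rcases hx with rfl | rfl | rfl
      · exact ⟨by simp, neg_one_ne_one_complex⟩
      · exact ⟨by simp, I_ne_one⟩
      · exact ⟨by simp, neg_I_ne_one⟩
    have hy' : ‖y‖ ≤ 1 := by
      rcases hy with rfl | rfl | rfl | rfl <;> simp
    exact ⟨_, ((seriesTendsto_double_one (by omega) hx'.1 hx'.2 hy').polylog_two (by omega)).1⟩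
  · intro x hx
    have hx' : ‖x‖ ≤ 1 := by
      rcases hx with rfl | rfl <;> simp
    exact ⟨_, ((seriesTendsto_doubleCoeff_of_tail (by omega) hx').polylog_two le_rfl).1⟩
  · rw [hval]
    congr 1
    have h1 := (tendsto_partsSum_at_one chiNegI m).sub
      ((tendsto_kernelIterated_at_one chiNegI hm).const_mul 4)
    obtain ⟨q, rfl⟩ := Nat.exists_eq_add_of_le' hm
    have h2 := (tendsto_partsSum_at_neg_I (q + 1)).sub
      ((tendsto_kernelIterated_at_neg_I q).const_mul 4)
    have key := tendsto_nhds_unique (h2.congr' (by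
      filter_upwards [eventually_stolzPath_mem, eventually_neg_I_mul_stolzPath_mem] with ε e1 e2
      exact partsSum_sub_eq chiNegI (q + 1) e2 e1)) h1
    -- The beta value of weight `m + 2` collects the diagonal terms `Li_{m+2}(±i)` left by the
    -- regularisation.
    have hbeta : 2 * Complex.I * (dirichletBeta (q + 1 + 2) : ℂ) =
        polylog ![q + 1 + 1 + 1] ![Complex.I] - polylog ![q + 1 + 1 + 1] ![-Complex.I] := by
      have := chiNegI_eq (q + 2)
      rw [chiNegI] at this
      linear_combination -2 * this
    have hsum1 : ∑ u ∈ Finset.HasAntidiagonal.antidiagonal (q + 1),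
        ∑ v ∈ Finset.HasAntidiagonal.antidiagonal u.2,
          2 * Complex.I * (-1) ^ v.1 * (dirichletBeta (v.2 + 1) : ℂ)
            * (2 - 1 / 2 ^ v.1) * polylog ![v.1 + 1] ![-1]
            * (1 / (Nat.factorial u.1 : ℂ)) * (Complex.I * (Real.pi : ℂ) / 2) ^ u.1 =
        4 * ∑ x ∈ Finset.HasAntidiagonal.antidiagonal (q + 1), chiNegI x.2 *
          ∑ y ∈ Finset.HasAntidiagonal.antidiagonal x.1,
            ((-1) ^ y.1 * (-(1 - 1 / 2 ^ (y.1 + 1)) * polylog ![y.1 + 1] ![-1])) *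
              ((Complex.I * (Real.pi : ℂ) / 2) ^ y.2 / (y.2.factorial : ℂ)) := by
      rw [← sum_antidiagonal_triple (fun k p r => 2 * Complex.I * (-1) ^ p *
        (dirichletBeta (r + 1) : ℂ) * (2 - 1 / 2 ^ p) * polylog ![p + 1] ![-1]
            * (1 / (Nat.factorial k : ℂ)) * (Complex.I * (Real.pi : ℂ) / 2) ^ k), Finset.mul_sum]
      refine Finset.sum_congr rfl fun x _ => ?_
      rw [Finset.mul_sum, Finset.mul_sum]
      refine Finset.sum_congr rfl fun y _ => ?_
      rw [chiNegI, pow_succ (2 : ℂ)]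
      ring
    have hsum2 : ∑ v ∈ Finset.HasAntidiagonal.antidiagonal (q + 1),
        2 * Complex.I * (-1) ^ (v.1 + 1) * (dirichletBeta (v.2 + 1) : ℂ)
          * (2 * polylog ![v.1 + 1] ![Complex.I]
              - (if 1 ≤ v.1 then polylog ![v.1 + 1] ![1] else 0)
              - polylog ![v.1 + 1] ![-1]) =
        -4 * (chiNegI (q + 1) * (-polylog ![1] ![Complex.I] + polylog ![1] ![-1] / 2) +
        ∑ x ∈ Finset.HasAntidiagonal.antidiagonal q, chiNegI x.2 *
          ((-1) ^ (x.1 + 1) * (-polylog ![x.1 + 2] ![Complex.I] +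
            (polylog ![x.1 + 2] ![1] + polylog ![x.1 + 2] ![-1]) / 2))) := by
      -- The summand `p = 0` is the regularised one: `Li_1(1)` has cancelled there, in accordance
      -- with its reading as `0`.
      rw [Finset.Nat.sum_antidiagonal_succ, mul_add, Finset.mul_sum]
      congr 1
      · simp only [zero_add, chiNegI]
        rw [if_neg (by norm_num)]
        ring
      · refine Finset.sum_congr rfl fun x _ => ?_
        dsimp only
        rw [if_pos (show 1 ≤ x.1 + 1 from Nat.succ_pos _), chiNegI]
        ring
    rw [hbeta, hsum1, hsum2]
    linear_combination key
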